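/- Let $\mathcal H$ be a separable complex Hilbert space and $\mathcal A\subset\mathbb B(\mathcal H)$ a C$^*$-algebra of bounded operators. An odd Fredholm module $(\mathcal H,F)$ for $\mathcal A$ is a unitary operator $F$ on $\mathcal H$ with $F^2=\mathbf 1$ and $\sigma_{\rm ess}(F)=\{-1,1\}$ such that $[F,A]$ is compact for all $A\in\mathcal A$. Put $P=\frac12(F+\mathbf 1)$. Let $\widehat{\mathbb{SF}}_*(\mathcal H)$ be the set of self-adjoint Fredholm operators of norm one with essential spectrum $\{-1,1\}$. For a norm continuous path $s\in[0,1]\mapsto F_s\in\widehat{\mathbb{SF}}_*(\mathcal H)$, choose a partition $0=s_0<\dots<s_N=1$ and numbers $-1<a_n<0<b_n<1$ such that $s\in[s_{n-1},s_n]\mapsto\chi_{(a_n,b_n]}(F_s)$ is norm continuous of constant finite rank, and define $$\mathrm{SF}(s\in[0,1]\mapsto F_s)=\sum_{n=1}^N\mathrm{Tr}\big(\chi_{(a_n,0]}(F_{s_{n-1}})-\chi_{(a_n,0]}(F_{s_n})\big)\in\mathbb Z .$$ Thus eigenvalues crossing $0$ upwards count positively. For a unitary $U$ on $\mathcal H$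 let $\Theta(F,U)$ be the set of norm continuous paths $s\in[0,1]\mapsto F_s\in\widehat{\mathbb{SF}}_*(\mathcal H)$ with $F_0=F$, $F_1=U^*FU$ and $F_s-F$ compact for all $s$, and let $\mathrm{SF}(F,U)$ denote the common value of the spectral flows of the paths in $\Theta(F,U)$. **Theorem.** Let $(\mathcal H,F)$ be an odd Fredholm module for $\mathcal A$ and let $U\in\mathcal A$ be a unitary operator on $\mathcal H$. Then $PUP$ is a Fredholm operator on $\mathrm{Ran}(P)$; the set $\Theta(F,U)$ is non-empty, admissible partitions exist for every path in it, and the spectral flow has the same value for all of these paths and all admissible choices of partition, so that $\mathrm{SF}(F,U)$ is well defined; and the odd index pairing, defined by $\langle(\mathcal H,F),[U]_1\rangle_1=\mathrm{Ind}(PUP)$ with $\mathrm{Ind}(T)=\dim\mathrm{Ker}(T)-\dim\mathrm{Ker}(T^*)$, satisfies $$\langle(\mathcal H,F),[U]_1\rangle_1=\mathrm{Ind}(PUP)=-\,\mathrm{SF}(F,U).$$ -/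

import Mathlib

noncomputable section

namespace SpectralFlowPairing

section Fredholm

variable {K : Type*} [NormedAddCommGroup K] [InnerProductSpace ℂ K] [CompleteSpace K]

/-- The Noether index `dim Ker T - dim Ker T*`. -/
def index (T : K →L[ℂ] K) : ℤ :=
  (Module.finrank ℂ T.ker : ℤ) - Module.finrank ℂ (ContinuousLinearMap.adjoint T).ker

/-- The essential spectrum: all `z` for which `T - z` is not Fredholm. -/
def essSpectrum (T : K →L[ℂ] K) : Set ℂ :=
  {z | ¬ (T - z • (1 : K →L[ℂ] K)).IsFredholm}

end Fredholm

variable {H : Type*} [NormedAddCommGroup H] [InnerProductSpace ℂ H] [CompleteSpace H]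

/-- The self-adjoint Fredholm operators of norm one with essential spectrum `{-1, 1}`.
(Fredholmness is the fact that `0` is not in the essential spectrum.) -/
def SFhat (H : Type*) [NormedAddCommGroup H] [InnerProductSpace ℂ H] [CompleteSpace H] :
    Set (H →L[ℂ] H) :=
  {F | IsSelfAdjoint F ∧ ‖F‖ = 1 ∧ essSpectrum F = {-1, 1}}

/-- The spectral projection `χ_{(-∞, c]}(F)` of a bounded self-adjoint operator `F`, that is, the
orthogonal projection onto the kernel of the positive part `(F - c)₊`. -/
def spectralProj (F : H →L[ℂ] H) (c : ℝ) : H →L[ℂ] H :=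
  (cfc (fun x : ℝ => max (x - c) 0) F : H →L[ℂ] H).ker.starProjection

/-- The spectral projection `χ_{(a, b]}(F)`, for `a ≤ b`. -/
def spectralProjIoc (F : H →L[ℂ] H) (a b : ℝ) : H →L[ℂ] H :=
  spectralProj F b - spectralProj F a

/-- The rank of a finite-rank operator; for an orthogonal projection it is the trace. -/
def rk (Q : H →L[ℂ] H) : ℕ := Module.finrank ℂ Q.range

/-- Data from which the spectral flow of the path `γ` on `[0, 1]` can be computed: a partition
`0 = s 0 < s 1 < ⋯ < s N = 1` and levels `a n < 0 < b n` such that, on the `n`-th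
interval `[s n, s (n + 1)]`, the projection `χ_{(a n, b n]}(γ t)` is norm continuous of constant
finite rank. -/
structure AdmissiblePartition (γ : ℝ → H →L[ℂ] H) where
  N : ℕ
  s : ℕ → ℝ
  a : ℕ → ℝ
  b : ℕ → ℝ
  s_zero : s 0 = 0
  s_last : s N = 1
  s_lt : ∀ n < N, s n < s (n + 1)
  a_mem : ∀ n < N, a n ∈ Set.Ioo (-1 : ℝ) 0
  b_mem : ∀ n < N, b n ∈ Set.Ioo (0 : ℝ) 1
  continuousOn : ∀ n < N,
    ContinuousOn (fun t => spectralProjIoc (γ t) (a n) (b n)) (Set.Icc (s n) (s (n + 1)))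
  finite_rank : ∀ n < N, ∀ t ∈ Set.Icc (s n) (s (n + 1)),
    FiniteDimensional ℂ (spectralProjIoc (γ t) (a n) (b n)).range
  constant_rank : ∀ n < N, ∀ t ∈ Set.Icc (s n) (s (n + 1)),
    rk (spectralProjIoc (γ t) (a n) (b n)) = rk (spectralProjIoc (γ (s n)) (a n) (b n))

/-- `∑ₙ Tr (χ_{(a n, 0]}(γ (s n)) - χ_{(a n, 0]}(γ (s (n + 1))))`. -/
def AdmissiblePartition.flow {γ : ℝ → H →L[ℂ] H} (D : AdmissiblePartition γ) : ℤ :=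
  ∑ n ∈ Finset.range D.N,
    ((rk (spectralProjIoc (γ (D.s n)) (D.a n) 0) : ℤ)
      - rk (spectralProjIoc (γ (D.s (n + 1))) (D.a n) 0))

/-- The path `γ` on `[0, 1]` has a well-defined spectral flow, equal to `m`: admissible partitions
exist and all of them give the value `m`. -/
def HasSpectralFlow (γ : ℝ → H →L[ℂ] H) (m : ℤ) : Prop :=
  Nonempty (AdmissiblePartition γ) ∧ ∀ D : AdmissiblePartition γ, D.flow = m

/-- `Θ(F, U)`: the norm continuous paths in `SFhat H` from `F` to `U* F U` by compact
perturbations of `F`. -/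
def Theta (F U : H →L[ℂ] H) : Set (ℝ → H →L[ℂ] H) :=
  {γ | ContinuousOn γ (Set.Icc 0 1) ∧ (∀ s ∈ Set.Icc (0 : ℝ) 1, γ s ∈ SFhat H) ∧
    γ 0 = F ∧ (∀ s ∈ Set.Icc (0 : ℝ) 1, IsCompactOperator (γ s - F)) ∧ γ 1 = star U * F * U}

/-- `m` is the common spectral flow of the paths in `Θ(F, U)`, of which there is at least one. -/
def IsSpectralFlowOfPair (F U : H →L[ℂ] H) (m : ℤ) : Prop :=
  (Theta F U).Nonempty ∧ ∀ γ ∈ Theta F U, HasSpectralFlow γ m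

open Classical in
/-- The spectral flow `SF(F, U)`: the common spectral flow of the paths in `Θ(F, U)` (and `0` by
convention if there is no such number). -/
def SF (F U : H →L[ℂ] H) : ℤ :=
  if h : ∃ m, IsSpectralFlowOfPair F U m then h.choose else 0

/-- An odd (bounded) Fredholm module `(H, F)` for an algebra `A` of operators on `H`. -/
structure OddFredholmModule (A : NonUnitalStarSubalgebra ℂ (H →L[ℂ] H)) where
  F : H →L[ℂ] H
  mem_unitary : F ∈ unitary (H →L[ℂ] H)
  sq_eq_one : F * F = 1
  essSpectrum_eq : essSpectrum F = {-1, 1}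
  isCompact_commutator : ∀ T ∈ A, IsCompactOperator (F * T - T * F)

namespace OddFredholmModule

variable {A : NonUnitalStarSubalgebra ℂ (H →L[ℂ] H)} (M : OddFredholmModule A)

/-- `P = (F + 1) / 2`. -/
def P : H →L[ℂ] H := (2⁻¹ : ℂ) • (M.F + 1)

theorem P_mul_P : M.P * M.P = M.P := by
  have h : (M.F + 1) * (M.F + 1) = (2 : ℂ) • (M.F + 1) := by
    rw [mul_add, add_mul, M.sq_eq_one, two_smul]; simp; abel
  rw [P, smul_mul_smul_comm, h, smul_smul]
  norm_num

/-- The Hilbert space `Ran P`. -/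
abbrev RanP : Submodule ℂ H := M.P.range

instance : CompleteSpace M.RanP := by
  have h : M.RanP = (1 - M.P : H →L[ℂ] H).ker := by
    ext x
    simp only [RanP, LinearMap.mem_range, LinearMap.mem_ker]
    constructor
    · rintro ⟨y, rfl⟩
      have := congrArg (fun T : H →L[ℂ] H => T y) M.P_mul_P
      simp at this ⊢
      simp [this]
    · intro hx
      refine ⟨x, ?_⟩
      simp [sub_eq_zero] at hx
      exact hx.symm
  rw [h]
  infer_instance

/-- `P U P` as an operator on `Ran P`. -/
def compression (U : H →L[ℂ] H) : M.RanP →L[ℂ] M.RanP :=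
  ((M.P * U * M.P) ∘L M.RanP.subtypeL).codRestrict M.RanP
    (fun x => ⟨U (M.P x), rfl⟩)

/-- The odd index pairing `⟨(H, F), [U]₁⟩₁ = Ind (P U P)`. -/
def pairing (U : H →L[ℂ] H) : ℤ := index (M.compression U)

end OddFredholmModule

end SpectralFlowPairing

end

/-! For a compact perturbation `T` of `F` and a level `c` in (-1, 1), let L(T, c) be the Fredholm
index of the orthogonal projection from Ran P to the spectral subspace of `T` for (c, ∞)
(`levelIndex`). Three facts carry the proof. Raising the level from c to d adds the rank of
χ_{(c,d]}(T) (`levelIndex_eq_add_rk`). At a fixed level, L is constant along a path as long as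
χ_{(-∞,c]} is norm continuous (`levelIndex_eq_of_continuousOn`). Continuity of χ_{(a,b]} along a
path already forces continuity of χ_{(-∞,a]} (`continuousOn_spectralProj_of_Ioc`).

Hence on each piece of a partition the terms at level a cancel, and the sum telescopes to L(F, 0) -
L(U*FU, 0), whatever the path and the partition (`flow_eq`). Here L(F, 0) = 0. The positive spectral
projection of U*FU is U*PU, and PUP = U(U*PU) on Ran P, so that PUP is the projection defining
L(U*FU, 0) followed by an isomorphism; its index is therefore L(U*FU, 0), and the minus sign
appears. -/

open Filter Topology Module LinearMap.FiniteRangeSetoid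

noncomputable section

namespace SpectralFlowPairing

/-! ### Fredholm operators: compact perturbations and local constancy of the index -/

section FredholmTheory

variable {X Y Z : Type*} [NormedAddCommGroup X] [InnerProductSpace ℂ X] [CompleteSpace X]
  [NormedAddCommGroup Y] [InnerProductSpace ℂ Y] [CompleteSpace Y]
  [NormedAddCommGroup Z] [InnerProductSpace ℂ Z] [CompleteSpace Z]

omit [CompleteSpace X] [CompleteSpace Y] in
/-- Compact operators into a Hilbert space are norm limits of finite-rank operators. -/
theorem exists_hasFiniteRange_norm_sub_lt {K : X →L[ℂ] Y} (hK : IsCompactOperator K) {ε : ℝ}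
    (hε : 0 < ε) : ∃ R : X →L[ℂ] Y, R.toLinearMap.HasFiniteRange ∧ ‖K - R‖ < ε := by
  obtain ⟨C, hC, hKC⟩ := hK.image_closedBall_subset_compact (f := K.toLinearMap) 1
  obtain ⟨t, htf, ht⟩ := Metric.totallyBounded_iff.mp hC.totallyBounded (ε / 2) (half_pos hε)
  let V : Submodule ℂ Y := Submodule.span ℂ t
  have hV : FiniteDimensional ℂ V := FiniteDimensional.span_of_finite ℂ htf
  refine ⟨V.starProjection ∘L K, ?_, ?_⟩
  · refine LinearMap.HasFiniteRange.comp_right (v := V.starProjection.toLinearMap) ?_ _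
    rw [LinearMap.hasFiniteRange_iff_range, Submodule.range_starProjection]
    exact (Submodule.fg_iff_finiteDimensional _).mpr hV
  · refine lt_of_le_of_lt (ContinuousLinearMap.opNorm_le_of_unit_norm (𝕜 := ℂ) (C := ε / 2)
      (half_pos hε).le ?_) (half_lt_self hε)
    intro x hx
    have hx' : K x ∈ C := hKC ⟨x, by simp [hx], rfl⟩
    obtain ⟨y, hy, hxy⟩ := Set.mem_iUnion₂.mp (ht hx')
    have h := Submodule.starProjection_minimal (U := V) (K x)
    have h2 : ‖K x - V.starProjection (K x)‖ ≤ ‖K x - y‖ := by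
      rw [h]
      exact ciInf_le ⟨0, by rintro _ ⟨z, rfl⟩; positivity⟩
        (⟨y, Submodule.subset_span hy⟩ : V)
    rw [Metric.mem_ball, dist_eq_norm] at hxy
    simpa using h2.trans hxy.le

/-- Operators that are invertible up to compact operators are invertible up to finite-rank ones. -/
theorem isQuasiInverse_of_one_sub_compact {K : X →L[ℂ] X} (hK : IsCompactOperator K) :
    ∃ G : X →L[ℂ] X, G.toLinearMap.IsQuasiInverse (1 + K : X →L[ℂ] X).toLinearMap := by
  obtain ⟨R, hR, hKR⟩ := exists_hasFiniteRange_norm_sub_lt hK one_pos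
  -- With `R` of finite rank and `K - R` of norm below 1, the Neumann series inverts 1 + (K - R);
  -- this inverse is a quasi-inverse of 1 + K.
  have hu : IsUnit (1 + (K - R) : X →L[ℂ] X) := by
    have := isUnit_one_sub_of_norm_lt_one (x := -(K - R)) (by rwa [norm_neg])
    rwa [sub_neg_eq_add] at this
  obtain ⟨u, hu⟩ := hu
  have h1 : (1 + K : X →L[ℂ] X) = u + R := by rw [hu]; abel
  refine ⟨↑u⁻¹, ?_, ?_⟩
  · rw [LinearMap.IsLeftQuasiInverse, h1, equiv_iff_hasFiniteRange]
    have h2 : (↑u⁻¹ : X →L[ℂ] X) * (u + R) - 1 = ↑u⁻¹ * R := by rw [mul_add]; simp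
    change ((↑u⁻¹ : X →L[ℂ] X) * (u + R) - 1).toLinearMap.HasFiniteRange
    rw [h2]
    exact hR.comp_left (↑u⁻¹ : X →L[ℂ] X).toLinearMap
  · rw [LinearMap.IsRightQuasiInverse, h1, equiv_iff_hasFiniteRange]
    have h2 : (u + R) * (↑u⁻¹ : X →L[ℂ] X) - 1 = R * ↑u⁻¹ := by rw [add_mul]; simp
    change ((u + R) * (↑u⁻¹ : X →L[ℂ] X) - 1).toLinearMap.HasFiniteRange
    rw [h2]
    exact hR.comp_right (↑u⁻¹ : X →L[ℂ] X).toLinearMap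

/-- Both sides improve to inverses modulo finite rank, `G ∘L S` on the left and `S' ∘L G'` on the
right. By associativity these agree modulo finite rank, so one of them is two-sided. -/
theorem isFredholm_of_inverse_mod_compact {T : X →L[ℂ] Y} {S S' : Y →L[ℂ] X}
    (hS : IsCompactOperator (S ∘L T - ContinuousLinearMap.id ℂ X))
    (hS' : IsCompactOperator (T ∘L S' - ContinuousLinearMap.id ℂ Y)) : T.IsFredholm := by
  obtain ⟨G, hG⟩ := isQuasiInverse_of_one_sub_compact hS
  obtain ⟨G', hG'⟩ := isQuasiInverse_of_one_sub_compact hS'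
  have e1 : (1 + (S ∘L T - ContinuousLinearMap.id ℂ X)) = S ∘L T := add_sub_cancel _ _
  have e2 : (1 + (T ∘L S' - ContinuousLinearMap.id ℂ Y)) = T ∘L S' := add_sub_cancel _ _
  rw [e1] at hG
  rw [e2] at hG'
  have h1 : (G ∘L S).toLinearMap ∘ₗ T.toLinearMap ≈ .id := hG.1
  have h2 : T.toLinearMap ∘ₗ (S' ∘L G').toLinearMap ≈ .id := hG'.2
  refine ContinuousLinearMap.IsFredholm.of_isQuasiInverse (v := G ∘L S) ⟨h1, ?_⟩
  have h3 : (G ∘L S).toLinearMap ≈ (S' ∘L G').toLinearMap := by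
    calc (G ∘L S).toLinearMap = (G ∘L S).toLinearMap ∘ₗ .id := rfl
      _ ≈ (G ∘L S).toLinearMap ∘ₗ (T.toLinearMap ∘ₗ (S' ∘L G').toLinearMap) :=
        equiv_comp_left (Setoid.symm h2)
      _ = ((G ∘L S).toLinearMap ∘ₗ T.toLinearMap) ∘ₗ (S' ∘L G').toLinearMap := rfl
      _ ≈ .id ∘ₗ (S' ∘L G').toLinearMap := equiv_comp_right h1
      _ = (S' ∘L G').toLinearMap := rfl
  exact Setoid.trans (equiv_comp_left h3) h2

omit [CompleteSpace X] [CompleteSpace Y] in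
theorem isCompactOperator_of_hasFiniteRange {R : X →L[ℂ] Y} (hR : R.toLinearMap.HasFiniteRange) :
    IsCompactOperator R := by
  have : FiniteDimensional ℂ R.range := (Submodule.fg_iff_finiteDimensional _).mp hR
  have h : IsCompactOperator (R.codRestrict R.range (fun x => ⟨x, rfl⟩)) :=
    by
    have : ProperSpace R.range := FiniteDimensional.proper ℂ R.range
    exact isCompactOperator_of_locallyCompactSpace_dom _
  exact h.clm_comp R.range.subtypeL

/-- Compact perturbations of Fredholm operators are Fredholm. -/
theorem isFredholm_add_compact {T K : X →L[ℂ] Y} (hT : T.IsFredholm) (hK : IsCompactOperator K) :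
    (T + K).IsFredholm := by
  obtain ⟨v, h1, h2⟩ := hT.exists_isQuasiInverse
  rw [LinearMap.IsLeftQuasiInverse, equiv_iff_hasFiniteRange] at h1
  rw [LinearMap.IsRightQuasiInverse, equiv_iff_hasFiniteRange] at h2
  refine isFredholm_of_inverse_mod_compact (S := v) (S' := v) ?_ ?_
  · have h3 := isCompactOperator_of_hasFiniteRange (R := v ∘L T - ContinuousLinearMap.id ℂ X) h1
    have h4 := h3.add (hK.clm_comp v)
    convert! h4 using 1
    funext x; simp; abel
  · have h3 := isCompactOperator_of_hasFiniteRange (R := T ∘L v - ContinuousLinearMap.id ℂ Y) h2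
    have h4 := h3.add (hK.comp_clm v)
    convert! h4 using 1
    funext x; simp; abel

omit [CompleteSpace X] [CompleteSpace Y] [CompleteSpace Z] in
theorem isFredholm_comp {S : Y →L[ℂ] Z} {T : X →L[ℂ] Y} (hS : S.IsFredholm) (hT : T.IsFredholm) :
    (S ∘L T).IsFredholm := by
  obtain ⟨v, hv⟩ := hT.exists_isQuasiInverse
  obtain ⟨w, hw⟩ := hS.exists_isQuasiInverse
  exact .of_isQuasiInverse (v := v ∘L w) (hv.comp hw)

omit [CompleteSpace X] [CompleteSpace Y] in
theorem isFredholm_of_continuousLinearEquiv (e : X ≃L[ℂ] Y) : (e : X →L[ℂ] Y).IsFredholm :=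
  .of_isQuasiInverse (v := (e.symm : Y →L[ℂ] X)) e.toLinearEquiv.isQuasiInverse

omit [CompleteSpace X] [CompleteSpace Y] in
theorem index_continuousLinearEquiv (e : X ≃L[ℂ] Y) : (e : X →L[ℂ] Y).toLinearMap.index = 0 :=
  LinearEquiv.index_eq_zero (e := e.toLinearEquiv)

omit [CompleteSpace X] [CompleteSpace Y] [CompleteSpace Z] in
theorem index_comp_of_isFredholm {S : Y →L[ℂ] Z} {T : X →L[ℂ] Y} (hS : S.IsFredholm)
    (hT : T.IsFredholm) :
    (S ∘L T).toLinearMap.index = S.toLinearMap.index + T.toLinearMap.index := by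
  have := hS.finite_ker
  have := hT.finite_ker
  have : FiniteDimensional ℂ (Y ⧸ T.range) := hT.finite_coker
  have : FiniteDimensional ℂ (Z ⧸ S.range) := hS.finite_coker
  exact LinearMap.index_comp S.toLinearMap

omit [CompleteSpace Y] in
/-- The index is locally constant on Fredholm operators. -/
theorem eventually_index_eq {T : X →L[ℂ] Y} (hT : T.IsFredholm) :
    ∀ᶠ S : X →L[ℂ] Y in 𝓝 T, S.IsFredholm → S.toLinearMap.index = T.toLinearMap.index := by
  obtain ⟨pkg⟩ := hT.nonempty_fredholmPackage
  have := pkg.decDom.finite_X₀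
  have := pkg.decCodom.finite_X₀
  have : CompleteSpace pkg.decDom.X₁ := pkg.decDom.isTopCompl.isClosed.completeSpace_coe
  set p := pkg.decCodom.proj
  set i := pkg.decDom.X₁.subtypeL
  have hp : p.IsFredholm := .of_isQuasiInverse (v := pkg.decCodom.X₁.subtypeL)
    (LinearMap.isQuasiInverse_subtype_projectionOnto _)
  have hi : i.IsFredholm := .of_isQuasiInverse (v := pkg.decDom.proj)
    (LinearMap.isQuasiInverse_subtype_projectionOnto _).symm
  -- Compress to the complements between which `T` is an isomorphism. Whenever p S i is invertible,
  -- additivity determines the index of `S` from those of the fixed maps `p` and `i`; invertibility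
  -- of p S i is an open condition on `S`.
  have key : ∀ S : X →L[ℂ] Y, S.IsFredholm →
      (∃ e : pkg.decDom.X₁ ≃L[ℂ] pkg.decCodom.X₁, (e : _ →L[ℂ] _) = p ∘L (S ∘L i)) →
      p.toLinearMap.index + (S.toLinearMap.index + i.toLinearMap.index) = 0 := by
    rintro S hS ⟨e, he⟩
    rw [← index_comp_of_isFredholm hS hi, ← index_comp_of_isFredholm hp (isFredholm_comp hS hi),
      ← he]
    exact index_continuousLinearEquiv e
  have hTe : (pkg.equiv : _ →L[ℂ] _) = p ∘L (T ∘L i) := by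
    have h : p ∘L (T ∘L i) =
        p ∘L ((pkg.decCodom.X₁.subtypeL ∘L pkg.equiv ∘L pkg.decDom.proj) ∘L i) :=
      congrArg (fun A : X →L[ℂ] Y => p ∘L (A ∘L i)) pkg.eq_equiv
    rw [h]
    ext x
    simp [p, i]
  have hc : Continuous fun S : X →L[ℂ] Y => p ∘L (S ∘L i) := by fun_prop
  have hev := (hc.tendsto T).eventually
    (p := fun A => A ∈ Set.range ((↑) : (pkg.decDom.X₁ ≃L[ℂ] pkg.decCodom.X₁) → _ →L[ℂ] _))
    (hTe ▸ ContinuousLinearEquiv.nhds pkg.equiv)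
  filter_upwards [hev] with S hS hSF
  have h1 := key S hSF hS
  have h2 := key T hT ⟨_, hTe⟩
  lia

/-- The range is closed, so its orthogonal complement, the kernel of the adjoint, is isomorphic to
the cokernel. -/
theorem index_eq_linearMap_index {T : X →L[ℂ] X} (hT : T.IsFredholm) :
    index T = T.toLinearMap.index := by
  have : CompleteSpace T.range := hT.isClosed_range.completeSpace_coe
  rw [index, LinearMap.index_eq_finrank_sub]
  have h : (ContinuousLinearMap.adjoint T).ker = T.rangeᗮ := T.orthogonal_range.symm
  rw [h]
  have h2 := (Submodule.quotientEquivOfIsCompl T.range T.rangeᗮ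
    (Submodule.isCompl_orthogonal _)).finrank_eq
  rw [← h2]
  

end FredholmTheory

/-! ### Relative index of two closed subspaces -/

section RelativeIndex

variable {H : Type*} [NormedAddCommGroup H] [InnerProductSpace ℂ H]

/-- The orthogonal projection onto `W`, as an operator from `V` to `W`. -/
def relProj (V W : Submodule ℂ H) [W.HasOrthogonalProjection] : V →L[ℂ] W :=
  W.orthogonalProjectionOnto ∘L V.subtypeL

/-- The relative index of two subspaces. -/
def relIndex (V W : Submodule ℂ H) [W.HasOrthogonalProjection] : ℤ :=
  (relProj V W).toLinearMap.index

@[simp]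
theorem coe_relProj (V W : Submodule ℂ H) [W.HasOrthogonalProjection] (x : V) :
    (relProj V W x : H) = W.starProjection x := rfl

theorem relIndex_eq_zero {V W : Submodule ℂ H} [W.HasOrthogonalProjection] (hVW : V = W) :
    relIndex V W = 0 := by
  subst hVW
  have h : (relProj V V).toLinearMap = LinearMap.id := by
    ext x
    simp
  rw [relIndex, h, LinearMap.index_id]

/-- The projection back from `W` to `V` is a parametrix: on `V` the round trip differs from the
identity by the compression of the compact operator P_W - P_V, and symmetrically on `W`. -/
theorem isFredholm_relProj {V W : Submodule ℂ H} [CompleteSpace V]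
    [CompleteSpace W]
    (h : IsCompactOperator (V.starProjection - W.starProjection)) :
    (relProj V W).IsFredholm := by
  have aux : ∀ (V W : Submodule ℂ H) [CompleteSpace V] [CompleteSpace W],
      IsCompactOperator (V.starProjection - W.starProjection) →
      IsCompactOperator (relProj W V ∘L relProj V W - ContinuousLinearMap.id ℂ V) := by
    intro V W _ _ h
    have h1 : IsCompactOperator (V.orthogonalProjectionOnto ∘L
        (W.starProjection - V.starProjection) ∘L V.subtypeL) := by
      have h2 : IsCompactOperator (W.starProjection - V.starProjection : H →L[ℂ] H) := by
        simpa using h.neg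
      exact (h2.comp_clm V.subtypeL).clm_comp V.orthogonalProjectionOnto
    convert! h1 using 2
    ext x
    have hx : V.starProjection (x : H) = x := Submodule.starProjection_eq_self_iff.mpr x.2
    simp [hx]
  refine isFredholm_of_inverse_mod_compact (S := relProj W V) (S' := relProj W V) (aux V W h)
    (aux W V ?_)
  simpa using h.neg

/-- The kernel of the projection from `W` to `W'`. -/
def kerRelProjEquiv (W W' : Submodule ℂ H) [CompleteSpace W'] :
    (relProj W W').ker ≃ₗ[ℂ] (W'ᗮ ⊓ W : Submodule ℂ H) where
  toFun x := ⟨x.1, (Submodule.starProjection_apply_eq_zero_iff _).mp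
    (congrArg (fun y : W' => (y : H)) x.2), x.1.2⟩
  invFun x := ⟨⟨x, x.2.2⟩, Subtype.ext ((Submodule.starProjection_apply_eq_zero_iff _).mpr x.2.1)⟩
  map_add' _ _ := rfl
  map_smul' _ _ := rfl
  left_inv _ := rfl
  right_inv _ := rfl

/-- The projection to `W'` factors through `W`, and the second factor is onto with kernel W ⊖ W'. -/
theorem relIndex_eq_add_finrank {V W W' : Submodule ℂ H} [CompleteSpace W]
    [CompleteSpace W'] (hVW : (relProj V W).IsFredholm)
    (hWW' : (relProj W W').IsFredholm) (hle : W' ≤ W) :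
    relIndex V W' = relIndex V W + finrank ℂ (W'ᗮ ⊓ W : Submodule ℂ H) := by
  have h1 : relProj V W' = relProj W W' ∘L relProj V W := by
    ext x
    have := DFunLike.congr_fun (Submodule.starProjection_comp_starProjection_of_le hle) (x : H)
    simpa using this.symm
  have h2 : (relProj W W').toLinearMap.index = finrank ℂ (W'ᗮ ⊓ W : Submodule ℂ H) := by
    rw [LinearMap.index_of_surjective, (kerRelProjEquiv W W').finrank_eq]
    intro y
    exact ⟨⟨y, hle y.2⟩, Subtype.ext (Submodule.starProjection_eq_self_iff.mpr y.2)⟩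
  rw [relIndex, h1, index_comp_of_isFredholm hWW' hVW, h2, relIndex, add_comm]

theorem finiteDimensional_of_isFredholm_relProj {W W' : Submodule ℂ H}
    [CompleteSpace W'] (hWW' : (relProj W W').IsFredholm) :
    FiniteDimensional ℂ (W'ᗮ ⊓ W : Submodule ℂ H) := by
  have := hWW'.finite_ker
  exact (kerRelProjEquiv W W').finiteDimensional

/-- Each round trip is the identity minus an operator of norm below 1, hence invertible; one gives
injectivity, the other surjectivity. -/
theorem bijective_relProj {V W : Submodule ℂ H} [CompleteSpace V]
    [CompleteSpace W] (h : ‖V.starProjection - W.starProjection‖ < 1) :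
    Function.Bijective (relProj V W) := by
  have aux : ∀ (V W : Submodule ℂ H) [CompleteSpace V] [CompleteSpace W],
      ‖V.starProjection - W.starProjection‖ < 1 →
      IsUnit (relProj W V ∘L relProj V W : V →L[ℂ] V) := by
    intro V W _ _ h
    have h1 : (relProj W V ∘L relProj V W : V →L[ℂ] V) = 1 - V.orthogonalProjectionOnto ∘L
        (V.starProjection - W.starProjection) ∘L V.subtypeL := by
      ext x
      have hx : V.starProjection (x : H) = x := Submodule.starProjection_eq_self_iff.mpr x.2
      simp [hx]
    rw [h1]
    refine isUnit_one_sub_of_norm_lt_one (x := V.orthogonalProjectionOnto ∘L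
        (V.starProjection - W.starProjection) ∘L V.subtypeL) (lt_of_le_of_lt ?_ h)
    calc _ ≤ ‖V.orthogonalProjectionOnto‖ * (‖V.starProjection - W.starProjection‖ *
          ‖V.subtypeL‖) := (ContinuousLinearMap.opNorm_comp_le _ _).trans
            (mul_le_mul_of_nonneg_left (ContinuousLinearMap.opNorm_comp_le _ _) (norm_nonneg _))
      _ ≤ 1 * (‖V.starProjection - W.starProjection‖ * 1) := by
          gcongr
          · exact V.orthogonalProjectionOnto_norm_le
          · exact V.norm_subtypeL_le
      _ = _ := by ring
  have h1 := ContinuousLinearMap.isUnit_iff_bijective.mp (aux V W h)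
  have h2 := ContinuousLinearMap.isUnit_iff_bijective.mp (aux W V (by rwa [norm_sub_rev]))
  exact ⟨Function.Injective.of_comp (f := relProj W V) h1.1,
    Function.Surjective.of_comp (g := relProj W V) h2.2⟩

/-- The relative index is locally constant in the second subspace. -/
theorem exists_relIndex_eq_of_norm_lt {V W : Submodule ℂ H} [CompleteSpace V]
    [CompleteSpace W] (h : IsCompactOperator (V.starProjection - W.starProjection)) :
    ∃ ε > 0, ∀ (W' : Submodule ℂ H) [CompleteSpace W'],
      IsCompactOperator (V.starProjection - W'.starProjection) →
      ‖W'.starProjection - W.starProjection‖ < ε → relIndex V W' = relIndex V W := by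
  obtain ⟨δ, hδ, hT⟩ := Metric.eventually_nhds_iff.mp
    (eventually_index_eq (isFredholm_relProj h))
  -- The bound 1 identifies `W'` with `W`, so that both operators have the same target; the bound
  -- `δ` then makes the index locally constant.
  refine ⟨min δ 1, by positivity, fun W' _ hc hW' => ?_⟩
  have hb := bijective_relProj (hW'.trans_le (min_le_right _ _))
  let e : W' ≃L[ℂ] W := ContinuousLinearEquiv.ofBijective (relProj W' W)
    (LinearMap.ker_eq_bot.mpr hb.1) (LinearMap.range_eq_top.mpr hb.2)
  have he : (e : W' →L[ℂ] W) = relProj W' W := ContinuousLinearMap.ext fun _ => rfl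
  have heF := isFredholm_of_continuousLinearEquiv e
  have h1 : ((e : W' →L[ℂ] W) ∘L relProj V W').toLinearMap.index = relIndex V W := by
    refine hT ?_ (isFredholm_comp heF (isFredholm_relProj hc))
    rw [dist_eq_norm, he]
    have h2 : relProj W' W ∘L relProj V W' - relProj V W = W.orthogonalProjectionOnto ∘L
        (W'.starProjection - W.starProjection) ∘L V.subtypeL := by
      ext x
      have hx : W.starProjection (W.starProjection (x : H)) = W.starProjection x :=
        Submodule.starProjection_eq_self_iff.mpr (Submodule.starProjection_apply_mem _ _)
      simp [hx]
    rw [h2]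
    refine lt_of_le_of_lt ?_ (hW'.trans_le (min_le_left _ _))
    calc _ ≤ ‖W.orthogonalProjectionOnto‖ * (‖W'.starProjection - W.starProjection‖ *
          ‖V.subtypeL‖) := (ContinuousLinearMap.opNorm_comp_le _ _).trans
            (mul_le_mul_of_nonneg_left (ContinuousLinearMap.opNorm_comp_le _ _) (norm_nonneg _))
      _ ≤ 1 * (‖W'.starProjection - W.starProjection‖ * 1) := by
          gcongr
          · exact W.orthogonalProjectionOnto_norm_le
          · exact V.norm_subtypeL_le
      _ = _ := by ring
  rw [index_comp_of_isFredholm heF (isFredholm_relProj hc)] at h1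
  rw [index_continuousLinearEquiv, zero_add] at h1
  exact h1

theorem index_equiv_comp_relProj {V W : Submodule ℂ H} [CompleteSpace V] [CompleteSpace W]
    (e : W ≃L[ℂ] V) (h : (relProj V W).IsFredholm) :
    index ((e : W →L[ℂ] V) ∘L relProj V W) = relIndex V W := by
  have he := isFredholm_of_continuousLinearEquiv e
  rw [index_eq_linearMap_index (isFredholm_comp he h), index_comp_of_isFredholm he h,
    index_continuousLinearEquiv, zero_add, relIndex]

end RelativeIndex

/-! ### Spectral projections, gaps in the spectrum and compact differences -/

section SpectralProjections

variable {H : Type*} [NormedAddCommGroup H] [InnerProductSpace ℂ H] [CompleteSpace H]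

/-- The spectral subspace of `T` for the interval `(-∞, c]`. -/
def spectralSubspace (T : H →L[ℂ] H) (c : ℝ) : Submodule ℂ H :=
  (cfc (fun x : ℝ => max (x - c) 0) T : H →L[ℂ] H).ker

instance (T : H →L[ℂ] H) (c : ℝ) : CompleteSpace (spectralSubspace T c) := by
  unfold spectralSubspace; infer_instance

theorem spectralProj_eq_starProjection (T : H →L[ℂ] H) (c : ℝ) :
    spectralProj T c = (spectralSubspace T c).starProjection := rfl

/-- The continuous function that is `1` on `(-∞, c]`, `0` on `[d, ∞)` and affine between. -/
def ramp (c d x : ℝ) : ℝ := max 0 (min 1 ((d - x) / (d - c)))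

@[fun_prop]
theorem continuous_ramp (c d : ℝ) : Continuous fun x => ramp c d x := by
  unfold ramp; fun_prop

theorem ramp_of_le {c d x : ℝ} (hcd : c < d) (hx : x ≤ c) : ramp c d x = 1 := by
  have : 1 ≤ (d - x) / (d - c) := by rw [le_div_iff₀ (sub_pos.mpr hcd)]; linarith
  simp [ramp, this]

theorem ramp_of_ge {c d x : ℝ} (hcd : c < d) (hx : d ≤ x) : ramp c d x = 0 := by
  have : (d - x) / (d - c) ≤ 0 :=
    div_nonpos_of_nonpos_of_nonneg (by linarith) (sub_pos.mpr hcd).le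
  simp [ramp, this]

theorem spectralSubspace_mono (T : H →L[ℂ] H) {c d : ℝ} (hcd : c ≤ d) :
    spectralSubspace T c ≤ spectralSubspace T d := by
  rcases hcd.eq_or_lt with rfl | hcd
  · exact le_rfl
  -- The truncated denominator never vanishes and equals x - c wherever (x - d)₊ is non-zero, so the
  -- quotient is continuous.
  have hpos : ∀ x : ℝ, max (x - c) (d - c) ≠ 0 := fun x =>
    (lt_max_of_lt_right (sub_pos.mpr hcd)).ne'
  have hg : Continuous fun x : ℝ => max (x - d) 0 / max (x - c) (d - c) :=
    .div (by fun_prop) (by fun_prop) hpos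
  have h : (cfc (fun x : ℝ => max (x - d) 0) T : H →L[ℂ] H) =
      cfc (fun x : ℝ => max (x - d) 0 / max (x - c) (d - c)) T *
        cfc (fun x : ℝ => max (x - c) 0) T := by
    rw [← cfc_mul _ _ T hg.continuousOn]
    congr 1
    funext x
    rcases le_total x d with hx | hx
    · simp [max_eq_right (sub_nonpos.mpr hx)]
    · rw [max_eq_left (sub_nonneg.mpr hx), max_eq_left (by linarith : d - c ≤ x - c),
        max_eq_left (by linarith : 0 ≤ x - c), div_mul_cancel₀]
      linarith
  intro v hv
  simp only [spectralSubspace, LinearMap.mem_ker] at hv ⊢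
  rw [h]
  exact (congrArg _ hv).trans (LinearMap.map_zero _)

/-- Next to a gap of the spectrum, the spectral projection is a continuous function of the
operator. -/
theorem spectralProj_eq_cfc_ramp {T : H →L[ℂ] H} (hT : IsSelfAdjoint T) {c d : ℝ} (hcd : c < d)
    (hgap : ∀ x ∈ spectrum ℝ T, x ≤ c ∨ d ≤ x) : spectralProj T c = cfc (ramp c d) T := by
  set f : ℝ → ℝ := fun x => max (x - c) 0 with hf
  have hpos : ∀ x : ℝ, max (x - c) (d - c) ≠ 0 := fun x =>
    (lt_max_of_lt_right (sub_pos.mpr hcd)).ne'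
  have hfc : Continuous f := by fun_prop
  have h1 : cfc f T * cfc (ramp c d) T = 0 := by
    rw [← cfc_mul _ _ T, ← cfc_const_zero ℝ T]
    refine cfc_congr fun x hx => ?_
    rcases hgap x hx with h | h
    · simp [hf, max_eq_right (sub_nonpos.mpr h)]
    · simp [ramp_of_ge hcd h]
  have hg : Continuous fun x : ℝ => (1 - ramp c d x) / max (x - c) (d - c) :=
    .div (by fun_prop) (by fun_prop) hpos
  -- `h1` puts the range of ramp(T) inside the kernel of f(T); this factorization makes 1 - ramp(T)
  -- vanish on that kernel. With self-adjointness, ramp(T) is the orthogonal projection onto it.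
  have h2 : 1 - cfc (ramp c d) T =
      cfc (fun x => (1 - ramp c d x) / max (x - c) (d - c)) T * cfc f T := by
    rw [← cfc_mul _ _ T hg.continuousOn, ← cfc_one ℝ T,
      ← cfc_sub _ _ T]
    refine cfc_congr fun x hx => ?_
    rcases hgap x hx with h | h
    · simp [hf, max_eq_right (sub_nonpos.mpr h), ramp_of_le hcd h]
    · have h3 : x - c ≠ 0 := by linarith
      simp [ramp_of_ge hcd h, hf, max_eq_left (by linarith : d - c ≤ x - c),
        max_eq_left (by linarith : 0 ≤ x - c), h3]
  have hsa : IsSelfAdjoint (1 - cfc (ramp c d) T) :=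
    (IsSelfAdjoint.one _).sub (cfc_predicate (ramp c d) T)
  ext v
  refine Submodule.eq_starProjection_of_mem_of_inner_eq_zero ?_ ?_
  · exact DFunLike.congr_fun h1 v
  · intro w hw
    have h3 : (1 - cfc (ramp c d) T) w = 0 := by
      rw [h2]
      exact (congrArg _ hw).trans (LinearMap.map_zero _)
    have h4 : v - cfc (ramp c d) T v = (1 - cfc (ramp c d) T) v := rfl
    rw [h4, ← ContinuousLinearMap.adjoint_inner_right, ← ContinuousLinearMap.star_eq_adjoint,
      hsa.star_eq, h3, inner_zero_right]

theorem spectralProj_eq_of_gap {T : H →L[ℂ] H} (hT : IsSelfAdjoint T) {a c d : ℝ} (hac : a ≤ c)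
    (hcd : c < d) (hgap : ∀ x ∈ spectrum ℝ T, x ≤ a ∨ d ≤ x) :
    spectralProj T a = spectralProj T c := by
  rw [spectralProj_eq_cfc_ramp hT (hac.trans_lt hcd) hgap,
    spectralProj_eq_cfc_ramp hT hcd fun x hx => (hgap x hx).imp_left fun h => h.trans hac]
  refine cfc_congr fun x hx => ?_
  rcases hgap x hx with h | h
  · rw [ramp_of_le (hac.trans_lt hcd) h, ramp_of_le hcd (h.trans hac)]
  · rw [ramp_of_ge (hac.trans_lt hcd) h, ramp_of_ge hcd h]

/-- The self-adjoint operators without spectrum in `[c, d]`. -/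
def gapSet (H : Type*) [NormedAddCommGroup H] [InnerProductSpace ℂ H] [CompleteSpace H]
    (c d : ℝ) : Set (H →L[ℂ] H) :=
  {T | IsSelfAdjoint T ∧ ∀ x ∈ spectrum ℝ T, x < c ∨ d < x}

theorem eventually_mem_gapSet {T : H →L[ℂ] H} {c d : ℝ} (hT : T ∈ gapSet H c d) :
    ∀ᶠ S in 𝓝 T, IsSelfAdjoint S → S ∈ gapSet H c d := by
  have h := (upperHemicontinuous_spectrum ℝ (H →L[ℂ] H)).upperHemicontinuousAt T
    (Set.Iio c ∪ Set.Ioi d) ((isOpen_Iio.union isOpen_Ioi).mem_nhdsSet.mpr hT.2)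
  filter_upwards [h] with S hS hsa
  exact ⟨hsa, fun x hx => subset_of_mem_nhdsSet hS hx⟩

/-- A common gap allows the same continuous ramp for all operators in the set, so continuity of the
functional calculus in the operator applies. -/
theorem continuousOn_spectralProj {c d : ℝ} (hcd : c < d) :
    ContinuousOn (fun T : H →L[ℂ] H => spectralProj T c) (gapSet H c d) := by
  have h : ContinuousOn (fun T : H →L[ℂ] H => cfc (ramp c d) T) (gapSet H c d) :=
    continuousOn_id.cfc_of_mem_nhdsSet (s := Set.univ) (ramp c d) univ_mem (fun T hT => hT.1)
  exact h.congr fun T hT => spectralProj_eq_cfc_ramp hT.1 hcd fun x hx =>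
    (hT.2 x hx).imp le_of_lt le_of_lt

omit [CompleteSpace H] in
theorem isCompactOperator_aeval_sub {T S : H →L[ℂ] H} (h : IsCompactOperator (T - S))
    (p : Polynomial ℝ) : IsCompactOperator (Polynomial.aeval T p - Polynomial.aeval S p) := by
  have hpow : ∀ n : ℕ, IsCompactOperator (T ^ n - S ^ n : H →L[ℂ] H) := by
    intro n
    induction n with
    | zero => simpa using isCompactOperator_zero
    | succ n ih =>
      have e : T ^ (n + 1) - S ^ (n + 1) = T ^ n * (T - S) + (T ^ n - S ^ n) * S := by
        rw [pow_succ, pow_succ]; noncomm_ring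
      have h1 : IsCompactOperator (T ^ n * (T - S) : H →L[ℂ] H) :=
        IsCompactOperator.clm_comp (f := (T - S : H →L[ℂ] H)) h (T ^ n)
      have h2 : IsCompactOperator ((T ^ n - S ^ n) * S : H →L[ℂ] H) :=
        IsCompactOperator.comp_clm (f := (T ^ n - S ^ n : H →L[ℂ] H)) ih S
      rw [e]
      exact h1.add h2
  induction p using Polynomial.induction_on' with
  | add p q hp hq =>
    have h1 := hp.add hq
    convert! h1 using 1
    funext x; simp; abel
  | monomial n r =>
    have h1 := (hpow n).smul r
    convert! h1 using 1
    funext x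
    simp [Polynomial.aeval_monomial, Algebra.algebraMap_eq_smul_one, smul_sub]

/-- Continuous functions of operators with compact difference have compact difference. -/
theorem isCompactOperator_cfc_sub {T S : H →L[ℂ] H} (hT : IsSelfAdjoint T) (hS : IsSelfAdjoint S)
    (h : IsCompactOperator (T - S)) {g : ℝ → ℝ} (hg : Continuous g) :
    IsCompactOperator (cfc g T - cfc g S : H →L[ℂ] H) := by
  obtain ⟨R, hR⟩ := (((ContinuousFunctionalCalculus.isCompact_spectrum (R := ℝ) T).union
    (ContinuousFunctionalCalculus.isCompact_spectrum (R := ℝ) S)).isBounded.subset_closedBall 0)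
  have hR' : ∀ A : H →L[ℂ] H, spectrum ℝ A ⊆ spectrum ℝ T ∪ spectrum ℝ S →
      ∀ x ∈ spectrum ℝ A, x ∈ Set.Icc (-R) R := fun A hA x hx => by
    have := hR (hA hx)
    rwa [Real.closedBall_eq_Icc, zero_sub, zero_add] at this
  have hcl := isClosed_setOfPred_isCompactOperator (σ₁₂ := RingHom.id ℂ) (M₁ := H) (M₂ := H)
  -- Weierstrass approximation on an interval containing both spectra reduces to polynomials, since
  -- the compact operators are norm closed.
  have : (cfc g T - cfc g S : H →L[ℂ] H) ∈ {f : H →L[ℂ] H | IsCompactOperator f} := by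
    rw [← hcl.closure_eq, Metric.mem_closure_iff]
    intro ε hε
    obtain ⟨p, hp⟩ := exists_polynomial_near_of_continuousOn (-R) R g hg.continuousOn (ε / 4)
      (by positivity)
    refine ⟨Polynomial.aeval T p - Polynomial.aeval S p, isCompactOperator_aeval_sub h p, ?_⟩
    have aux : ∀ A : H →L[ℂ] H, IsSelfAdjoint A →
        spectrum ℝ A ⊆ spectrum ℝ T ∪ spectrum ℝ S →
        ‖cfc g A - Polynomial.aeval A p‖ ≤ ε / 4 := by
      intro A hA hAs
      rw [← cfc_polynomial p A, ← cfc_sub _ _ A]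
      refine norm_cfc_le (by positivity) fun x hx => ?_
      rw [← norm_neg, neg_sub]
      exact (hp x (hR' A hAs x hx)).le
    have e : cfc g T - cfc g S - (Polynomial.aeval T p - Polynomial.aeval S p) =
      (cfc g T - Polynomial.aeval T p) - (cfc g S - Polynomial.aeval S p) := by abel
    rw [dist_eq_norm, e]
    have h1 := aux T hT Set.subset_union_left
    have h2 := aux S hS Set.subset_union_right
    have h3 := norm_sub_le (cfc g T - Polynomial.aeval T p) (cfc g S - Polynomial.aeval S p)
    linarith
  exact this

omit [CompleteSpace H] in
theorem mem_spectrum_real_iff {T : H →L[ℂ] H} {x : ℝ} :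
    x ∈ spectrum ℝ T ↔ ¬ IsUnit (T - (x : ℂ) • (1 : H →L[ℂ] H)) := by
  rw [spectrum.mem_iff, ← IsUnit.neg_iff, neg_sub, Algebra.algebraMap_eq_smul_one]
  rfl

/-- A real point at which a self-adjoint operator is Fredholm is isolated in the spectrum. -/
theorem exists_gap_of_isFredholm {T : H →L[ℂ] H} (hT : IsSelfAdjoint T) {z : ℝ}
    (hF : (T - (z : ℂ) • (1 : H →L[ℂ] H)).IsFredholm) :
    ∃ δ > 0, ∀ x ∈ spectrum ℝ T, x = z ∨ δ ≤ |x - z| := by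
  set S := T - (z : ℂ) • (1 : H →L[ℂ] H) with hSdef
  have hS : IsSelfAdjoint S := by
    refine hT.sub ?_
    rw [IsSelfAdjoint, star_smul, star_one]
    simp
  have hperp : S.rangeᗮ = S.ker := by
    rw [S.orthogonal_range, ← ContinuousLinearMap.star_eq_adjoint, hS.star_eq]
  have : CompleteSpace S.range := hF.isClosed_range.completeSpace_coe
  set p := S.ker.starProjection
  have hrange : ∀ y, p (S y) = 0 := fun y => by
    rw [Submodule.starProjection_apply_eq_zero_iff, ← hperp]
    exact Submodule.le_orthogonal_orthogonal _ ⟨y, rfl⟩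
  have hker : ∀ y, S (p y) = 0 := fun y => S.ker.starProjection_apply_mem y
  have hpp : ∀ y, p (p y) = p y := fun y =>
    Submodule.starProjection_eq_self_iff.mpr (Submodule.starProjection_apply_mem _ _)
  -- `S` is block diagonal for ker S ⊕ ran S and invertible on the range; adding the kernel
  -- projection `p` repairs the kernel block. For small w ≠ 0, S + p - w stays invertible, and S - w
  -- differs from it only on the kernel, where it is -w.
  have hunit : IsUnit (S + p) := by
    rw [ContinuousLinearMap.isUnit_iff_bijective]
    constructor
    · rw [injective_iff_map_eq_zero]
      intro x hx
      have h1 : p x = 0 := by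
        have := congrArg p hx
        simpa [hrange, hpp] using this
      have h2 : S x = 0 := by simpa [h1] using hx
      rw [← h1]
      exact (Submodule.starProjection_eq_self_iff.mpr h2).symm
    · intro y
      obtain ⟨u, ⟨v, rfl⟩, w, hw, rfl⟩ := S.range.exists_add_mem_mem_orthogonal y
      rw [hperp] at hw
      refine ⟨v - p v + w, ?_⟩
      have h1 : p w = w := Submodule.starProjection_eq_self_iff.mpr hw
      have h2 : S w = 0 := hw
      simp [hker, hpp, h1, h2]
  have hopen : ∀ᶠ w : ℂ in 𝓝 0, IsUnit (S + p - w • (1 : H →L[ℂ] H)) := by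
    have hc : Continuous fun w : ℂ => S + p - w • (1 : H →L[ℂ] H) := by fun_prop
    exact (hc.tendsto 0).eventually (Units.isOpen.mem_nhds (by simpa using hunit))
  obtain ⟨δ, hδ, hball⟩ := Metric.eventually_nhds_iff.mp hopen
  refine ⟨δ, hδ, fun x hx => ?_⟩
  by_contra! hne
  obtain ⟨hxz, hlt⟩ := hne
  rw [mem_spectrum_real_iff] at hx
  apply hx
  set w : ℂ := ((x - z : ℝ) : ℂ) with hw
  have hw0 : w ≠ 0 := by
    rw [hw, Complex.ofReal_ne_zero]; exact sub_ne_zero.mpr hxz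
  have hu := hball (y := w) (by rw [hw, dist_zero_right, Complex.norm_real]; exact hlt)
  have e1 : T - (x : ℂ) • (1 : H →L[ℂ] H) = S - w • 1 := by
    rw [hSdef, hw]; push_cast; rw [sub_smul]; abel
  rw [e1]
  have hu' := ContinuousLinearMap.isUnit_iff_bijective.mp hu
  rw [ContinuousLinearMap.isUnit_iff_bijective]
  constructor
  · rw [injective_iff_map_eq_zero]
    intro y hy
    have h1 : p y = 0 := by
      have := congrArg p hy
      simpa [hrange, hw0] using this
    refine (injective_iff_map_eq_zero _).mp hu'.1 y ?_
    have h2 : S y - w • y = 0 := by simpa using hy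
    simp [h1, h2]
  · intro y
    obtain ⟨x, hx⟩ := hu'.2 y
    refine ⟨x - w⁻¹ • p x, ?_⟩
    rw [← hx]
    simp [hker, smul_sub, smul_smul, hw0]
    abel

theorem exists_gap_of_mem_SFhat {T : H →L[ℂ] H} (hT : T ∈ SFhat H) {z : ℝ}
    (hz : z ∈ Set.Ioo (-1 : ℝ) 1) : ∃ δ > 0, ∀ x ∈ spectrum ℝ T, x = z ∨ δ ≤ |x - z| := by
  refine exists_gap_of_isFredholm hT.1 ?_
  by_contra h
  have h1 : (z : ℂ) ∈ essSpectrum T := h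
  rw [hT.2.2] at h1
  rcases h1 with h1 | h1
  · exact hz.1.ne' (by exact_mod_cast h1)
  · exact hz.2.ne (by exact_mod_cast Set.mem_singleton_iff.mp h1)

/-- `z` may itself be an eigenvalue, so the gap is taken strictly to its right; shifting the level
into it leaves χ_{(-∞,z]} unchanged. -/
theorem exists_gap_right_of_mem_SFhat {T : H →L[ℂ] H} (hT : T ∈ SFhat H) {z : ℝ}
    (hz : z ∈ Set.Ioo (-1 : ℝ) 1) {u : ℝ} (hu : z < u) :
    ∃ c d, z < c ∧ c < d ∧ d < u ∧ ∀ x ∈ spectrum ℝ T, x ≤ z ∨ d < x := by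
  obtain ⟨δ, hδ, h⟩ := exists_gap_of_mem_SFhat hT hz
  set m := min δ (u - z)
  have hm : 0 < m := lt_min hδ (sub_pos.mpr hu)
  have hm1 : m ≤ δ := min_le_left _ _
  have hm2 : m ≤ u - z := min_le_right _ _
  refine ⟨z + m / 3, z + m / 2, by linarith, by linarith, by linarith, fun x hx => ?_⟩
  rcases h x hx with h | h
  · exact Or.inl h.le
  · rcases le_abs.mp h with h | h
    · right; linarith
    · left; linarith

end SpectralProjections

/-! ### Symmetries, and continuity of projections along paths -/

section SpectralFlow

variable {H : Type*} [NormedAddCommGroup H] [InnerProductSpace ℂ H] [CompleteSpace H]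

/-- The spectrum lies in {-1, 1}, where the ramp agrees with (1 - x)/2. -/
theorem spectralProj_of_sq_eq_one {T : H →L[ℂ] H} (hT : IsSelfAdjoint T) (hsq : T * T = 1) {c : ℝ}
    (hc : c ∈ Set.Ioo (-1 : ℝ) 1) : spectralProj T c = (2⁻¹ : ℂ) • (1 - T) := by
  have hspec : ∀ x ∈ spectrum ℝ T, x = -1 ∨ x = 1 := by
    intro x hx
    by_contra! hne
    rw [mem_spectrum_real_iff] at hx
    apply hx
    have hx2 : (1 - (x : ℂ) * x) ≠ 0 := by
      intro h
      have h' : (1 + x) * (1 - x) = 0 := by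
        have : (1 - x * x : ℝ) = 0 := by exact_mod_cast h
        linarith
      rcases mul_eq_zero.mp h' with h' | h'
      · exact hne.1 (by linarith)
      · exact hne.2 (by linarith)
    have e1 : (T - (x : ℂ) • (1 : H →L[ℂ] H)) * (T + (x : ℂ) • 1) = (1 - (x : ℂ) * x) • 1 := by
      simp only [sub_mul, mul_add, hsq, smul_mul_assoc, mul_smul_comm, one_mul, mul_one, sub_smul,
        smul_smul, one_smul, smul_sub]
      abel
    have e2 : (T + (x : ℂ) • (1 : H →L[ℂ] H)) * (T - (x : ℂ) • 1) = (1 - (x : ℂ) * x) • 1 := by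
      simp only [add_mul, mul_sub, hsq, smul_mul_assoc, mul_smul_comm, one_mul, mul_one, sub_smul,
        smul_smul, one_smul, smul_add]
      abel
    refine ⟨⟨_, (1 - (x : ℂ) * x)⁻¹ • (T + (x : ℂ) • 1), ?_, ?_⟩, rfl⟩
    · rw [mul_smul_comm, e1, smul_smul, inv_mul_cancel₀ hx2, one_smul]
    · rw [smul_mul_assoc, e2, smul_smul, inv_mul_cancel₀ hx2, one_smul]
  rw [spectralProj_eq_cfc_ramp hT hc.2 fun x hx => (hspec x hx).imp
    (fun h => by rw [h]; exact hc.1.le) (fun h => h.ge)]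
  have h1 : cfc (ramp c 1) T = cfc (fun x : ℝ => 2⁻¹ * (1 - x)) T := by
    refine cfc_congr fun x hx => ?_
    rcases hspec x hx with rfl | rfl
    · rw [ramp_of_le hc.2 hc.1.le]; norm_num
    · rw [ramp_of_ge hc.2 le_rfl]; norm_num
  rw [h1, cfc_const_mul _ _ T, cfc_sub _ _ T, cfc_const_one ℝ T, cfc_id' ℝ T]
  ext v
  simp only [smul_apply]
  rw [← Complex.coe_smul]
  norm_num

theorem starProjection_orthogonal_spectralSubspace (T : H →L[ℂ] H) (c : ℝ) :
    (spectralSubspace T c)ᗮ.starProjection = 1 - spectralProj T c :=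
  Submodule.starProjection_orthogonal' _

omit [CompleteSpace H] in
theorem range_starProjection_sub {V W : Submodule ℂ H} [CompleteSpace V] [CompleteSpace W]
    (h : V ≤ W) : (W.starProjection - V.starProjection).range = W ⊓ Vᗮ := by
  ext x
  constructor
  · rintro ⟨y, rfl⟩
    refine ⟨W.sub_mem (W.starProjection_apply_mem y) (h (V.starProjection_apply_mem y)), ?_⟩
    have h1 : V.starProjection (W.starProjection y) = V.starProjection y :=
      DFunLike.congr_fun (Submodule.starProjection_comp_starProjection_of_le h) y
    have h2 : V.starProjection (V.starProjection y) = V.starProjection y :=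
      Submodule.starProjection_eq_self_iff.mpr (V.starProjection_apply_mem y)
    rw [SetLike.mem_coe, ← Submodule.starProjection_apply_eq_zero_iff]
    simp [h1, h2]
  · rintro ⟨hW, hV⟩
    refine ⟨x, ?_⟩
    have h1 : W.starProjection x = x := Submodule.starProjection_eq_self_iff.mpr hW
    have h2 : V.starProjection x = 0 := (Submodule.starProjection_apply_eq_zero_iff _).mpr hV
    simp [h1, h2]

omit [CompleteSpace H] in
-- A vector of V₁ ⊖ V is fixed by the first difference of projections and killed by the second, so a
-- norm below 1 forces it to vanish.
theorem eq_of_norm_starProjection_sub_lt_one {V V₁ W W₁ : Submodule ℂ H} [CompleteSpace V]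
    [CompleteSpace V₁] [CompleteSpace W] [CompleteSpace W₁] (h₁ : V ≤ V₁) (h₂ : V₁ ≤ W)
    (h₃ : W ≤ W₁) (h : ‖(W.starProjection - V.starProjection) -
      (W₁.starProjection - V₁.starProjection)‖ < 1) : V = V₁ := by
  refine le_antisymm h₁ fun x hx => ?_
  set y := x - V.starProjection x with hy
  have hyV₁ : y ∈ V₁ := V₁.sub_mem hx (h₁ (V.starProjection_apply_mem x))
  have e0 : V.starProjection y = 0 := (Submodule.starProjection_apply_eq_zero_iff _).mpr
    (V.sub_starProjection_mem_orthogonal x)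
  have e1 : V₁.starProjection y = y := Submodule.starProjection_eq_self_iff.mpr hyV₁
  have e2 : W.starProjection y = y := Submodule.starProjection_eq_self_iff.mpr (h₂ hyV₁)
  have e3 : W₁.starProjection y = y := Submodule.starProjection_eq_self_iff.mpr (h₃ (h₂ hyV₁))
  have h4 := ContinuousLinearMap.le_opNorm ((W.starProjection - V.starProjection) -
      (W₁.starProjection - V₁.starProjection)) y
  simp only [sub_apply, e0, e1, e2, e3, sub_zero, sub_self] at h4
  have h5 : ‖y‖ = 0 := by
    by_contra h6
    have := lt_of_le_of_ne (norm_nonneg y) (Ne.symm h6)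
    nlinarith
  have h7 : x = V.starProjection x := sub_eq_zero.mp (norm_eq_zero.mp h5)
  rw [h7]
  exact V.starProjection_apply_mem x

/-- If the projections `χ_{(a, b]}` depend continuously on the point of a continuous path, then so
do the projections `χ_{(-∞, a]}`. -/
theorem continuousOn_spectralProj_of_Ioc {γ : ℝ → H →L[ℂ] H} {I : Set ℝ} (hγ : ContinuousOn γ I)
    (hSF : ∀ t ∈ I, γ t ∈ SFhat H) {a b : ℝ} (ha : a ∈ Set.Ioo (-1 : ℝ) 0)
    (hb : b ∈ Set.Ioo (0 : ℝ) 1)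
    (hc : ContinuousOn (fun t => spectralProjIoc (γ t) a b) I) :
    ContinuousOn (fun t => spectralProj (γ t) a) I := by
  intro t₀ ht₀
  obtain ⟨a₁, a₂, ha₁, ha₁₂, ha₂, hgapa⟩ := exists_gap_right_of_mem_SFhat (hSF t₀ ht₀)
    (z := a) ⟨ha.1, ha.2.trans one_pos⟩ ha.2
  obtain ⟨b₁, b₂, hb₁, hb₁₂, hb₂, hgapb⟩ := exists_gap_right_of_mem_SFhat (hSF t₀ ht₀)
    (z := b) ⟨by linarith [hb.1], hb.2⟩ hb.2
  have hsa : ∀ t ∈ I, IsSelfAdjoint (γ t) := fun t ht => (hSF t ht).1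
  have key : ∀ c c₁ c₂ : ℝ, c < c₁ → c₁ < c₂ →
      (∀ x ∈ spectrum ℝ (γ t₀), x ≤ c ∨ c₂ < x) →
      Tendsto (fun t => spectralProj (γ t) c₁) (𝓝[I] t₀) (𝓝 (spectralProj (γ t₀) c)) := by
    intro c c₁ c₂ h₁ h₂ hgap
    have hmem : γ t₀ ∈ gapSet H c₁ c₂ :=
      ⟨hsa t₀ ht₀, fun x hx => (hgap x hx).imp_left fun h => h.trans_lt h₁⟩
    have hev : ∀ᶠ t in 𝓝[I] t₀, γ t ∈ gapSet H c₁ c₂ := by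
      filter_upwards [(hγ t₀ ht₀).eventually (eventually_mem_gapSet hmem), self_mem_nhdsWithin]
        with t ht htI using ht (hsa t htI)
    rw [spectralProj_eq_of_gap (hsa t₀ ht₀) h₁.le h₂ fun x hx => (hgap x hx).imp_right le_of_lt]
    exact (continuousOn_spectralProj h₂ _ hmem).tendsto.comp
      (tendsto_nhdsWithin_iff.mpr ⟨hγ t₀ ht₀, hev⟩)
  have hA := key a a₁ a₂ ha₁ ha₁₂ hgapa
  have hB := key b b₁ b₂ hb₁ hb₁₂ hgapb
  have hD := (hc t₀ ht₀).tendsto.sub (hB.sub hA)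
  rw [spectralProjIoc, sub_self] at hD
  -- χ_{(a,b]} and χ_{(a₁,b₁]} coincide at `t₀` and are both continuous there. Near `t₀` they are
  -- closer than 1, which excludes spectrum in (a, a₁] and transfers continuity from level `a₁` to
  -- level `a`.
  have hev : ∀ᶠ t in 𝓝[I] t₀, spectralProj (γ t) a₁ = spectralProj (γ t) a := by
    filter_upwards [hD.norm.eventually (gt_mem_nhds (by simp : ‖(0 : H →L[ℂ] H)‖ < 1))] with t ht
    have h := eq_of_norm_starProjection_sub_lt_one (spectralSubspace_mono (γ t) ha₁.le)
      (spectralSubspace_mono (γ t) (by linarith [hb.1] : a₁ ≤ b))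
      (spectralSubspace_mono (γ t) hb₁.le) ht
    rw [spectralProj_eq_starProjection, spectralProj_eq_starProjection]
    congr 1
    exact h.symm
  exact hA.congr' hev

end SpectralFlow

/-! ### Stability of the essential spectrum -/

section CompactPerturbations

variable {H : Type*} [NormedAddCommGroup H] [InnerProductSpace ℂ H] [CompleteSpace H]

omit [CompleteSpace H] in
theorem isFredholm_of_isUnit {T : H →L[ℂ] H} (hT : IsUnit T) : T.IsFredholm := by
  obtain ⟨u, rfl⟩ := hT
  exact isFredholm_of_continuousLinearEquiv (ContinuousLinearEquiv.unitsEquiv ℂ H u)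

theorem essSpectrum_subset_of_isCompactOperator_sub {T S : H →L[ℂ] H}
    (h : IsCompactOperator (T - S)) : essSpectrum S ⊆ essSpectrum T := by
  intro z hz hT
  apply hz
  have h1 : IsCompactOperator (-(T - S) : H →L[ℂ] H) := h.neg
  have h2 := isFredholm_add_compact hT h1
  rwa [show T - z • (1 : H →L[ℂ] H) + -(T - S) = S - z • 1 by abel] at h2

theorem essSpectrum_eq_of_isCompactOperator_sub {T S : H →L[ℂ] H}
    (h : IsCompactOperator (T - S)) : essSpectrum T = essSpectrum S := by
  refine (essSpectrum_subset_of_isCompactOperator_sub ?_).antisymm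
    (essSpectrum_subset_of_isCompactOperator_sub h)
  have h1 : IsCompactOperator (-(T - S) : H →L[ℂ] H) := h.neg
  simpa using h1

omit [CompleteSpace H] in
theorem nontrivial_of_mem_essSpectrum {T : H →L[ℂ] H} {z : ℂ} (hz : z ∈ essSpectrum T) :
    Nontrivial H := by
  by_contra h
  rw [not_nontrivial_iff_subsingleton] at h
  exact hz (isFredholm_of_isUnit (isUnit_of_subsingleton _))

theorem norm_le_norm_of_mem_essSpectrum {T : H →L[ℂ] H} {z : ℂ} (hz : z ∈ essSpectrum T) :
    ‖z‖ ≤ ‖T‖ := by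
  have := nontrivial_of_mem_essSpectrum hz
  refine spectrum.norm_le_norm_of_mem (𝕜 := ℂ) (a := T) ?_
  rw [spectrum.mem_iff, ← IsUnit.neg_iff, neg_sub, Algebra.algebraMap_eq_smul_one]
  exact fun h => hz (isFredholm_of_isUnit h)

/-- Only the lower norm bound needs an argument: 1 remains in the essential spectrum, hence in the
spectrum. -/
theorem mem_SFhat_of_isCompactOperator_sub {T S : H →L[ℂ] H} (hT : IsSelfAdjoint T)
    (hnorm : ‖T‖ ≤ 1) (hS : essSpectrum S = {-1, 1}) (h : IsCompactOperator (T - S)) :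
    T ∈ SFhat H := by
  have he := (essSpectrum_eq_of_isCompactOperator_sub h).trans hS
  refine ⟨hT, le_antisymm hnorm ?_, he⟩
  have h1 := norm_le_norm_of_mem_essSpectrum (T := T) (z := 1) (by rw [he]; simp)
  simpa using h1

end CompactPerturbations

/-! ### The level index and the spectral flow of a path -/

namespace OddFredholmModule

variable {H : Type*} [NormedAddCommGroup H] [InnerProductSpace ℂ H] [CompleteSpace H]
  {A : NonUnitalStarSubalgebra ℂ (H →L[ℂ] H)} (M : OddFredholmModule A)

theorem isSelfAdjoint_F : IsSelfAdjoint M.F := by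
  have h := Unitary.star_mul_self_of_mem M.mem_unitary
  calc star M.F = star M.F * (M.F * M.F) := by rw [M.sq_eq_one, mul_one]
    _ = M.F := by rw [← mul_assoc, h, one_mul]

theorem norm_F_le : ‖M.F‖ ≤ 1 := by
  have : Nontrivial H := nontrivial_of_mem_essSpectrum (T := M.F) (z := 1)
    (by rw [M.essSpectrum_eq]; simp)
  exact (CStarRing.norm_of_mem_unitary M.mem_unitary).le

theorem F_mem_SFhat : M.F ∈ SFhat H :=
  mem_SFhat_of_isCompactOperator_sub M.isSelfAdjoint_F M.norm_F_le M.essSpectrum_eq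
    (by simpa using isCompactOperator_zero)

theorem spectralProj_F {c : ℝ} (hc : c ∈ Set.Ioo (-1 : ℝ) 1) : spectralProj M.F c = 1 - M.P := by
  rw [spectralProj_of_sq_eq_one M.isSelfAdjoint_F M.sq_eq_one hc, P]
  have h : (1 : H →L[ℂ] H) = (2⁻¹ : ℂ) • ((1 : H →L[ℂ] H) + 1) := by
    rw [smul_add, ← add_smul]; norm_num
  nth_rw 2 [h]
  rw [← smul_sub]
  congr 1
  abel

theorem RanP_eq {c : ℝ} (hc : c ∈ Set.Ioo (-1 : ℝ) 1) : M.RanP = (spectralSubspace M.F c)ᗮ := by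
  rw [← Submodule.range_starProjection (spectralSubspace M.F c)ᗮ,
    starProjection_orthogonal_spectralSubspace, M.spectralProj_F hc, sub_sub_cancel]

theorem starProjection_RanP : M.RanP.starProjection = M.P := by
  have h0 : (0 : ℝ) ∈ Set.Ioo (-1 : ℝ) 1 := by norm_num
  have h := starProjection_orthogonal_spectralSubspace M.F 0
  rw [M.spectralProj_F h0, sub_sub_cancel] at h
  rw [← h]
  congr 1
  exact M.RanP_eq h0

/-- The compact perturbations of `F` with the same essential spectrum. -/
def perturbations : Set (H →L[ℂ] H) := {T | T ∈ SFhat H ∧ IsCompactOperator (T - M.F)}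

/-- The relative index of `Ran P` and the spectral subspace of `T` for `(c, ∞)`. -/
def levelIndex (T : H →L[ℂ] H) (c : ℝ) : ℤ := relIndex M.RanP (spectralSubspace T c)ᗮ

variable {M}

/-- `T` and `F` share a gap to the right of `c`, so one ramp represents both projections. -/
theorem isCompactOperator_spectralProj_sub {T : H →L[ℂ] H} (hT : T ∈ M.perturbations) {c : ℝ}
    (hc : c ∈ Set.Ioo (-1 : ℝ) 1) :
    IsCompactOperator (spectralProj T c - spectralProj M.F c : H →L[ℂ] H) := by
  obtain ⟨d₁, d, h₁, h₂, -, hgap⟩ := exists_gap_right_of_mem_SFhat hT.1 hc hc.2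
  obtain ⟨d₁', d', h₁', h₂', -, hgap'⟩ := exists_gap_right_of_mem_SFhat M.F_mem_SFhat hc hc.2
  have hlt : c < min d d' := lt_min (h₁.trans h₂) (h₁'.trans h₂')
  rw [spectralProj_eq_cfc_ramp hT.1.1 hlt fun x hx =>
      (hgap x hx).imp_right fun h => (min_le_left _ _).trans h.le,
    spectralProj_eq_cfc_ramp M.isSelfAdjoint_F hlt fun x hx =>
      (hgap' x hx).imp_right fun h => (min_le_right _ _).trans h.le]
  exact isCompactOperator_cfc_sub hT.1.1 M.isSelfAdjoint_F hT.2 (continuous_ramp _ _)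

theorem isCompactOperator_starProjection_sub {T : H →L[ℂ] H} (hT : T ∈ M.perturbations) {c : ℝ}
    (hc : c ∈ Set.Ioo (-1 : ℝ) 1) :
    IsCompactOperator (M.RanP.starProjection - (spectralSubspace T c)ᗮ.starProjection) := by
  have h := isCompactOperator_spectralProj_sub hT hc
  rw [M.spectralProj_F hc] at h
  rw [M.starProjection_RanP, starProjection_orthogonal_spectralSubspace]
  rwa [show M.P - (1 - spectralProj T c) = spectralProj T c - (1 - M.P) by abel]

theorem isFredholm_relProj_spectralSubspace {T : H →L[ℂ] H} (hT : T ∈ M.perturbations) {c d : ℝ}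
    (hc : c ∈ Set.Ioo (-1 : ℝ) 1) (hd : d ∈ Set.Ioo (-1 : ℝ) 1) :
    (relProj (spectralSubspace T c)ᗮ (spectralSubspace T d)ᗮ).IsFredholm := by
  refine isFredholm_relProj ?_
  have h := (isCompactOperator_starProjection_sub hT hd).sub
    (isCompactOperator_starProjection_sub hT hc)
  convert! h using 1
  funext x
  simp

theorem range_spectralProjIoc (T : H →L[ℂ] H) {c d : ℝ} (hcd : c ≤ d) :
    (spectralProjIoc T c d).range = (spectralSubspace T d)ᗮᗮ ⊓ (spectralSubspace T c)ᗮ := by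
  rw [Submodule.orthogonal_orthogonal]
  exact range_starProjection_sub (spectralSubspace_mono T hcd)

theorem finiteDimensional_range_spectralProjIoc {T : H →L[ℂ] H} (hT : T ∈ M.perturbations)
    {c d : ℝ} (hc : c ∈ Set.Ioo (-1 : ℝ) 1) (hd : d ∈ Set.Ioo (-1 : ℝ) 1) (hcd : c ≤ d) :
    FiniteDimensional ℂ (spectralProjIoc T c d).range := by
  rw [range_spectralProjIoc T hcd]
  exact finiteDimensional_of_isFredholm_relProj (isFredholm_relProj_spectralSubspace hT hc hd)

/-- A higher level shrinks the target subspace by exactly the range of χ_{(c,d]}(T), which becomes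
additional kernel. -/
theorem levelIndex_eq_add_rk {T : H →L[ℂ] H} (hT : T ∈ M.perturbations)
    {c d : ℝ} (hc : c ∈ Set.Ioo (-1 : ℝ) 1) (hd : d ∈ Set.Ioo (-1 : ℝ) 1) (hcd : c ≤ d) :
    M.levelIndex T d = M.levelIndex T c + rk (spectralProjIoc T c d) := by
  rw [rk, range_spectralProjIoc T hcd]
  exact relIndex_eq_add_finrank (isFredholm_relProj (isCompactOperator_starProjection_sub hT hc))
    (isFredholm_relProj_spectralSubspace hT hc hd)
    (Submodule.orthogonal_le (spectralSubspace_mono T hcd))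

theorem levelIndex_F {c : ℝ} (hc : c ∈ Set.Ioo (-1 : ℝ) 1) : M.levelIndex M.F c = 0 :=
  relIndex_eq_zero (M.RanP_eq hc)

theorem levelIndex_eq_of_continuousOn {γ : ℝ → H →L[ℂ] H} {I : Set ℝ} (hI : IsPreconnected I)
    (hγ : ∀ t ∈ I, γ t ∈ M.perturbations) {c : ℝ} (hc : c ∈ Set.Ioo (-1 : ℝ) 1)
    (hcont : ContinuousOn (fun t => spectralProj (γ t) c) I) {s t : ℝ} (hs : s ∈ I) (ht : t ∈ I) :
    M.levelIndex (γ s) c = M.levelIndex (γ t) c := by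
  refine hI.constant (f := fun t => M.levelIndex (γ t) c) ?_ hs ht
  intro t₀ ht₀
  obtain ⟨ε, hε, h⟩ := exists_relIndex_eq_of_norm_lt
    (isCompactOperator_starProjection_sub (hγ t₀ ht₀) hc)
  have hev : ∀ᶠ t in 𝓝[I] t₀, M.levelIndex (γ t) c = M.levelIndex (γ t₀) c := by
    filter_upwards [(hcont t₀ ht₀).eventually (Metric.ball_mem_nhds _ hε), self_mem_nhdsWithin]
      with t ht htI
    refine h _ (isCompactOperator_starProjection_sub (hγ t htI) hc) ?_
    rw [starProjection_orthogonal_spectralSubspace, starProjection_orthogonal_spectralSubspace,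
      sub_sub_sub_cancel_left, norm_sub_rev]
    exact mem_ball_iff_norm.mp ht
  exact (tendsto_const_nhds.congr' (hev.mono fun _ h => h.symm))

/-- Along an admissible partition the flow telescopes. -/
theorem flow_eq {γ : ℝ → H →L[ℂ] H} (hcont : ContinuousOn γ (Set.Icc 0 1))
    (hγ : ∀ t ∈ Set.Icc (0 : ℝ) 1, γ t ∈ M.perturbations) (D : AdmissiblePartition γ) :
    D.flow = M.levelIndex (γ 0) 0 - M.levelIndex (γ 1) 0 := by
  have hmono : ∀ m n, m ≤ n → n ≤ D.N → D.s m ≤ D.s n := by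
    intro m n hmn
    induction n, hmn using Nat.le_induction with
    | base => intro _; exact le_rfl
    | succ n _ ih => exact fun hn => (ih (by lia)).trans (D.s_lt n (by lia)).le
  have hmem : ∀ n ≤ D.N, D.s n ∈ Set.Icc (0 : ℝ) 1 := fun n hn =>
    ⟨D.s_zero ▸ hmono 0 n (Nat.zero_le _) hn, D.s_last ▸ hmono n D.N hn le_rfl⟩
  have h0 : (0 : ℝ) ∈ Set.Ioo (-1 : ℝ) 1 := by norm_num
  have hterm : ∀ n ∈ Finset.range D.N,
      ((rk (spectralProjIoc (γ (D.s n)) (D.a n) 0) : ℤ)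
        - rk (spectralProjIoc (γ (D.s (n + 1))) (D.a n) 0)) =
      M.levelIndex (γ (D.s n)) 0 - M.levelIndex (γ (D.s (n + 1))) 0 := by
    intro n hn
    have hn := Finset.mem_range.mp hn
    have ha := D.a_mem n hn
    have ha' : D.a n ∈ Set.Ioo (-1 : ℝ) 1 := ⟨ha.1, ha.2.trans one_pos⟩
    have hsub : Set.Icc (D.s n) (D.s (n + 1)) ⊆ Set.Icc 0 1 :=
      Set.Icc_subset_Icc (hmem n hn.le).1 (hmem (n + 1) hn).2
    have hle := (D.s_lt n hn).le
    -- The index at level `D.a n` agrees at both ends, so it cancels once the two ranks are written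
    -- as differences of level indices.
    have h1 := levelIndex_eq_of_continuousOn isPreconnected_Icc (fun t ht => hγ t (hsub ht)) ha'
      (continuousOn_spectralProj_of_Ioc (hcont.mono hsub) (fun t ht => (hγ t (hsub ht)).1) ha
        (D.b_mem n hn) (D.continuousOn n hn)) (Set.left_mem_Icc.mpr hle)
      (Set.right_mem_Icc.mpr hle)
    have h2 := levelIndex_eq_add_rk (hγ _ (hmem n hn.le)) ha' h0 ha.2.le
    have h3 := levelIndex_eq_add_rk (hγ _ (hmem (n + 1) hn)) ha' h0 ha.2.le
    lia
  rw [AdmissiblePartition.flow, Finset.sum_congr rfl hterm,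
    Finset.sum_range_sub' (fun n => M.levelIndex (γ (D.s n)) 0), D.s_zero, D.s_last]

/-- Gaps above a negative and above a positive level persist near each time; a Lebesgue number then
yields a uniform partition with such gaps on every piece. -/
theorem nonempty_admissiblePartition {γ : ℝ → H →L[ℂ] H} (hcont : ContinuousOn γ (Set.Icc 0 1))
    (hγ : ∀ t ∈ Set.Icc (0 : ℝ) 1, γ t ∈ M.perturbations) : Nonempty (AdmissiblePartition γ) := by
  have hloc : ∀ t ∈ Set.Icc (0 : ℝ) 1, ∃ a a' b b' : ℝ, a ∈ Set.Ioo (-1 : ℝ) 0 ∧ a < a' ∧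
      b ∈ Set.Ioo (0 : ℝ) 1 ∧ b < b' ∧ ∃ ε > 0, ∀ t' ∈ Set.Icc (0 : ℝ) 1 ∩ Metric.ball t ε,
        γ t' ∈ gapSet H a a' ∩ gapSet H b b' := by
    intro t ht
    have hSF := (hγ t ht).1
    -- Any starting point in (-1, 0) would serve in place of -1/2.
    obtain ⟨a, a', ha, haa', ha', hgapa⟩ := exists_gap_right_of_mem_SFhat hSF (z := -1 / 2)
      (by norm_num) (u := 0) (by norm_num)
    obtain ⟨b, b', hb, hbb', hb', hgapb⟩ := exists_gap_right_of_mem_SFhat hSF (z := 0)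
      (by norm_num) one_pos
    refine ⟨a, a', b, b', ⟨by linarith, by linarith⟩, haa', ⟨hb, by linarith⟩, hbb', ?_⟩
    have ea : γ t ∈ gapSet H a a' := ⟨hSF.1, fun x hx => (hgapa x hx).imp_left fun h => by linarith⟩
    have eb : γ t ∈ gapSet H b b' := ⟨hSF.1, fun x hx => (hgapb x hx).imp_left fun h => by linarith⟩
    obtain ⟨ε, hε, h⟩ := Metric.mem_nhdsWithin_iff.mp
      ((hcont t ht).eventually ((eventually_mem_gapSet ea).and (eventually_mem_gapSet eb)))
    exact ⟨ε, hε, fun t' ht' => ⟨(h ht'.symm).1 (hγ t' ht'.1).1.1, (h ht'.symm).2 (hγ t' ht'.1).1.1⟩⟩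
  choose! a a' b b' ha haa' hb hbb' ε hε hgap using hloc
  obtain ⟨δ, hδ, hleb⟩ := lebesgue_number_lemma_of_metric (isCompact_Icc (a := (0 : ℝ)) (b := 1))
    (c := fun t : Set.Icc (0 : ℝ) 1 => Metric.ball (t : ℝ) (ε t)) (fun _ => Metric.isOpen_ball)
    (fun t ht => Set.mem_iUnion.mpr ⟨⟨t, ht⟩, Metric.mem_ball_self (hε t ht)⟩)
  obtain ⟨N, hN⟩ := exists_nat_one_div_lt hδ
  have hN0 : (0 : ℝ) < (N + 1 : ℕ) := by positivity
  have hs : ∀ n ≤ N + 1, (n : ℝ) / (N + 1 : ℕ) ∈ Set.Icc (0 : ℝ) 1 := fun n hn =>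
    ⟨by positivity, (div_le_one hN0).mpr (by exact_mod_cast hn)⟩
  have hcover : ∀ n : ℕ, ∃ t : ℝ, n < N + 1 → t ∈ Set.Icc (0 : ℝ) 1 ∧
      Metric.ball ((n : ℝ) / (N + 1 : ℕ)) δ ⊆ Metric.ball t (ε t) := by
    intro n
    by_cases hn : n < N + 1
    · obtain ⟨t, ht⟩ := hleb _ (hs n hn.le)
      exact ⟨t, fun _ => ⟨t.2, ht⟩⟩
    · exact ⟨0, fun h => absurd h hn⟩
  choose τ hτ using hcover
  have hsub : ∀ n < N + 1, Set.Icc ((n : ℝ) / (N + 1 : ℕ)) ((n + 1 : ℕ) / (N + 1 : ℕ)) ⊆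
      Set.Icc (0 : ℝ) 1 ∩ Metric.ball (τ n) (ε (τ n)) := by
    intro n hn t ht
    refine ⟨⟨(hs n hn.le).1.trans ht.1, ht.2.trans (hs (n + 1) hn).2⟩, (hτ n hn).2 ?_⟩
    rw [Metric.mem_ball, Real.dist_eq, abs_of_nonneg (sub_nonneg.mpr ht.1)]
    have h1 : ((n + 1 : ℕ) : ℝ) / (N + 1 : ℕ) - n / (N + 1 : ℕ) = 1 / (N + 1) := by
      push_cast; ring
    linarith [ht.2]
  have hA : ∀ n < N + 1, ContinuousOn (fun t => spectralProj (γ t) (a (τ n)))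
      (Set.Icc ((n : ℝ) / (N + 1 : ℕ)) ((n + 1 : ℕ) / (N + 1 : ℕ))) := fun n hn =>
    (continuousOn_spectralProj (haa' _ (hτ n hn).1)).comp
      (hcont.mono fun t ht => (hsub n hn ht).1)
      fun t ht => (hgap _ (hτ n hn).1 t (hsub n hn ht)).1
  have hB : ∀ n < N + 1, ContinuousOn (fun t => spectralProj (γ t) (b (τ n)))
      (Set.Icc ((n : ℝ) / (N + 1 : ℕ)) ((n + 1 : ℕ) / (N + 1 : ℕ))) := fun n hn =>
    (continuousOn_spectralProj (hbb' _ (hτ n hn).1)).comp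
      (hcont.mono fun t ht => (hsub n hn ht).1)
      fun t ht => (hgap _ (hτ n hn).1 t (hsub n hn ht)).2
  have hlt : ∀ n : ℕ, (n : ℝ) / (N + 1 : ℕ) < (n + 1 : ℕ) / (N + 1 : ℕ) := fun n =>
    div_lt_div_of_pos_right (by push_cast; linarith) hN0
  have ha1 : ∀ n < N + 1, a (τ n) ∈ Set.Ioo (-1 : ℝ) 1 := fun n hn =>
    ⟨(ha _ (hτ n hn).1).1, (ha _ (hτ n hn).1).2.trans one_pos⟩
  have hb1 : ∀ n < N + 1, b (τ n) ∈ Set.Ioo (-1 : ℝ) 1 := fun n hn =>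
    ⟨by linarith [(hb _ (hτ n hn).1).1], (hb _ (hτ n hn).1).2⟩
  have hab : ∀ n < N + 1, a (τ n) ≤ b (τ n) := fun n hn =>
    ((ha _ (hτ n hn).1).2.trans (hb _ (hτ n hn).1).1).le
  have hγ' : ∀ n < N + 1, ∀ t ∈ Set.Icc ((n : ℝ) / (N + 1 : ℕ)) ((n + 1 : ℕ) / (N + 1 : ℕ)),
      γ t ∈ M.perturbations := fun n hn t ht => hγ t (hsub n hn ht).1
  refine ⟨⟨N + 1, fun n => (n : ℝ) / (N + 1 : ℕ), fun n => a (τ n), fun n => b (τ n), by simp,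
    div_self hN0.ne', fun n _ => hlt n, fun n hn => ha _ (hτ n hn).1, fun n hn => hb _ (hτ n hn).1,
    fun n hn => (hB n hn).sub (hA n hn), fun n hn t ht =>
      finiteDimensional_range_spectralProjIoc (hγ' n hn t ht) (ha1 n hn) (hb1 n hn) (hab n hn),
    fun n hn t ht => ?_⟩⟩
  -- The rank of χ_{(a,b]} is the difference of the level indices at `b` and `a`, both constant on
  -- the piece.
  have hleft := Set.left_mem_Icc.mpr (hlt n).le
  have h1 := levelIndex_eq_add_rk (hγ' n hn t ht) (ha1 n hn) (hb1 n hn) (hab n hn)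
  have h2 := levelIndex_eq_add_rk (hγ' n hn _ hleft) (ha1 n hn) (hb1 n hn) (hab n hn)
  have h3 := levelIndex_eq_of_continuousOn isPreconnected_Icc (hγ' n hn) (ha1 n hn) (hA n hn)
    ht hleft
  have h4 := levelIndex_eq_of_continuousOn isPreconnected_Icc (hγ' n hn) (hb1 n hn) (hB n hn)
    ht hleft
  lia

end OddFredholmModule

/-! ### The pair F, U*FU and the compression PUP -/

namespace OddFredholmModule

variable {H : Type*} [NormedAddCommGroup H] [InnerProductSpace ℂ H] [CompleteSpace H]
  {A : NonUnitalStarSubalgebra ℂ (H →L[ℂ] H)} {M : OddFredholmModule A} {U : H →L[ℂ] H}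

theorem isCompactOperator_conj_sub (hU : U ∈ unitary (H →L[ℂ] H))
    (hUF : IsCompactOperator (M.F * U - U * M.F)) :
    IsCompactOperator (star U * M.F * U - M.F : H →L[ℂ] H) := by
  have h1 : IsCompactOperator (star U * (M.F * U - U * M.F) : H →L[ℂ] H) :=
    IsCompactOperator.clm_comp (f := (M.F * U - U * M.F : H →L[ℂ] H)) hUF (star U)
  rwa [mul_sub, ← mul_assoc, ← mul_assoc, Unitary.star_mul_self_of_mem hU, one_mul] at h1

theorem isSelfAdjoint_conj : IsSelfAdjoint (star U * M.F * U) := by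
  have h := M.isSelfAdjoint_F.conjugate (star U)
  rwa [star_star] at h

theorem norm_conj_le (hU : U ∈ unitary (H →L[ℂ] H)) : ‖star U * M.F * U‖ ≤ 1 := by
  rw [CStarRing.norm_mul_mem_unitary _ hU, CStarRing.norm_mem_unitary_mul _ (Unitary.star_mem hU)]
  exact M.norm_F_le

theorem conj_mem_perturbations (hU : U ∈ unitary (H →L[ℂ] H))
    (hUF : IsCompactOperator (M.F * U - U * M.F)) : star U * M.F * U ∈ M.perturbations :=
  ⟨mem_SFhat_of_isCompactOperator_sub isSelfAdjoint_conj (norm_conj_le hU) M.essSpectrum_eq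
    (isCompactOperator_conj_sub hU hUF), isCompactOperator_conj_sub hU hUF⟩

/-- The straight line from `F` to `U* F U` lies in `Θ(F, U)`. -/
theorem nonempty_Theta (hU : U ∈ unitary (H →L[ℂ] H))
    (hUF : IsCompactOperator (M.F * U - U * M.F)) : (Theta M.F U).Nonempty := by
  have hK := isCompactOperator_conj_sub hU hUF
  have hsub : ∀ s : ℝ, IsCompactOperator
      (AffineMap.lineMap M.F (star U * M.F * U) s - M.F : H →L[ℂ] H) := by
    intro s
    have h1 : IsCompactOperator (s • (star U * M.F * U - M.F) : H →L[ℂ] H) := hK.smul s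
    rwa [AffineMap.lineMap_apply, vsub_eq_sub, vadd_eq_add, add_sub_cancel_right]
  refine ⟨fun s => AffineMap.lineMap M.F (star U * M.F * U) s, ?_, fun s hs => ?_, by simp,
    fun s _ => hsub s, by simp⟩
  · exact AffineMap.lineMap_continuous.continuousOn
  · refine mem_SFhat_of_isCompactOperator_sub ?_ ?_ M.essSpectrum_eq (hsub s)
    · change IsSelfAdjoint (AffineMap.lineMap M.F (star U * M.F * U) s)
      rw [AffineMap.lineMap_apply_module]
      exact ((IsSelfAdjoint.all (1 - s)).smul M.isSelfAdjoint_F).add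
        ((IsSelfAdjoint.all s).smul isSelfAdjoint_conj)
    · have hmem := (convex_closedBall (0 : H →L[ℂ] H) 1).lineMap_mem (x := M.F)
        (y := star U * M.F * U) (by simpa using M.norm_F_le) (by simpa using norm_conj_le hU) hs
      simpa using hmem

theorem starProjection_conj (hU : U ∈ unitary (H →L[ℂ] H)) :
    (spectralSubspace (star U * M.F * U) 0)ᗮ.starProjection = star U * M.P * U := by
  have hsq : star U * M.F * U * (star U * M.F * U) = 1 := by
    calc star U * M.F * U * (star U * M.F * U)
        = star U * M.F * (U * star U) * M.F * U := by simp only [mul_assoc]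
      _ = star U * (M.F * M.F) * U := by
          rw [Unitary.mul_star_self_of_mem hU, mul_one]; simp only [mul_assoc]
      _ = 1 := by rw [M.sq_eq_one, mul_one, Unitary.star_mul_self_of_mem hU]
  rw [starProjection_orthogonal_spectralSubspace,
    spectralProj_of_sq_eq_one isSelfAdjoint_conj hsq (by norm_num), P]
  rw [mul_smul_comm, smul_mul_assoc, mul_add, add_mul, mul_one, Unitary.star_mul_self_of_mem hU]
  have h : (1 : H →L[ℂ] H) = (2⁻¹ : ℂ) • ((1 : H →L[ℂ] H) + 1) := by
    rw [smul_add, ← add_smul]; norm_num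
  nth_rw 1 [h]
  rw [← smul_sub]
  congr 1
  abel

/-- `U` maps the positive spectral subspace of `U* F U` onto that of `F`. -/
def conjEquiv (M : OddFredholmModule A) (hU : U ∈ unitary (H →L[ℂ] H)) :
    ((spectralSubspace (star U * M.F * U) 0)ᗮ : Submodule ℂ H) ≃L[ℂ] M.RanP :=
  have hUU : ∀ y, U (star U y) = y := fun y =>
    DFunLike.congr_fun (Unitary.mul_star_self_of_mem hU) y
  have hUU' : ∀ y, star U (U y) = y := fun y =>
    DFunLike.congr_fun (Unitary.star_mul_self_of_mem hU) y
  ContinuousLinearEquiv.equivOfInverse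
    ((U ∘L Submodule.subtypeL _).codRestrict M.RanP fun x => by
      refine ⟨U x, ?_⟩
      have h : star U (M.P (U x)) = x :=
        (DFunLike.congr_fun (starProjection_conj hU) (x : H)).symm.trans
          (Submodule.starProjection_eq_self_iff.mpr x.2)
      have h2 := congrArg U h
      rwa [hUU] at h2)
    ((star U ∘L M.RanP.subtypeL).codRestrict _ fun y => by
      rw [← Submodule.starProjection_eq_self_iff, starProjection_conj hU]
      have h : M.P y = y := by
        rw [← M.starProjection_RanP]
        exact Submodule.starProjection_eq_self_iff.mpr y.2
      change star U (M.P (U (star U y))) = star U y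
      rw [hUU, h])
    (fun x => Subtype.ext (hUU' x)) (fun y => Subtype.ext (hUU y))

/-- On Ran P, PUP = U(U*PU), and U*PU projects onto the positive spectral subspace of U*FU. -/
theorem compression_eq (hU : U ∈ unitary (H →L[ℂ] H)) :
    M.compression U = (M.conjEquiv hU : _ →L[ℂ] M.RanP) ∘L
      relProj M.RanP (spectralSubspace (star U * M.F * U) 0)ᗮ := by
  ext x
  have h1 : M.P x = x := by
    rw [← M.starProjection_RanP]
    exact Submodule.starProjection_eq_self_iff.mpr x.2
  have h2 : ((M.compression U x : M.RanP) : H) = M.P (U (M.P x)) := rfl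
  have h3 : (((M.conjEquiv hU : _ →L[ℂ] M.RanP) ∘L
      relProj M.RanP (spectralSubspace (star U * M.F * U) 0)ᗮ) x : H) =
      U ((spectralSubspace (star U * M.F * U) 0)ᗮ.starProjection x) := rfl
  have h4 : U (star U (M.P (U x))) = M.P (U x) :=
    DFunLike.congr_fun (Unitary.mul_star_self_of_mem hU) _
  rw [h2, h1, h3, starProjection_conj hU]
  exact h4.symm

theorem isFredholm_compression (hU : U ∈ unitary (H →L[ℂ] H))
    (hUF : IsCompactOperator (M.F * U - U * M.F)) : (M.compression U).IsFredholm := by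
  rw [compression_eq hU]
  exact isFredholm_comp (isFredholm_of_continuousLinearEquiv _)
    (isFredholm_relProj (isCompactOperator_starProjection_sub (conj_mem_perturbations hU hUF)
      (by norm_num)))

theorem pairing_eq_levelIndex (hU : U ∈ unitary (H →L[ℂ] H))
    (hUF : IsCompactOperator (M.F * U - U * M.F)) :
    M.pairing U = M.levelIndex (star U * M.F * U) 0 := by
  have h := isFredholm_relProj (isCompactOperator_starProjection_sub
    (conj_mem_perturbations hU hUF) (c := 0) (by norm_num))
  rw [pairing, compression_eq hU]
  exact index_equiv_comp_relProj (M.conjEquiv hU) h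

theorem isSpectralFlowOfPair (hU : U ∈ unitary (H →L[ℂ] H))
    (hUF : IsCompactOperator (M.F * U - U * M.F)) :
    IsSpectralFlowOfPair M.F U (-M.pairing U) := by
  refine ⟨nonempty_Theta hU hUF, fun γ hγ => ?_⟩
  obtain ⟨hcont, hSF, h0, hK, h1⟩ := hγ
  have hper : ∀ t ∈ Set.Icc (0 : ℝ) 1, γ t ∈ M.perturbations := fun t ht => ⟨hSF t ht, hK t ht⟩
  refine ⟨nonempty_admissiblePartition hcont hper, fun D => ?_⟩
  rw [flow_eq hcont hper D, h0, h1, levelIndex_F (by norm_num), zero_sub,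
    pairing_eq_levelIndex hU hUF]

end OddFredholmModule

/-- Uniqueness rests on the existence of a path and of an admissible partition; it identifies the
value chosen in `SF`. -/
theorem IsSpectralFlowOfPair.unique {H : Type*} [NormedAddCommGroup H] [InnerProductSpace ℂ H]
    [CompleteSpace H] {F U : H →L[ℂ] H} {m n : ℤ} (hm : IsSpectralFlowOfPair F U m)
    (hn : IsSpectralFlowOfPair F U n) : m = n := by
  obtain ⟨γ, hγ⟩ := hm.1
  obtain ⟨⟨D⟩, h⟩ := hm.2 γ hγ
  exact (h D).symm.trans ((hn.2 γ hγ).2 D)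

theorem IsSpectralFlowOfPair.SF_eq {H : Type*} [NormedAddCommGroup H] [InnerProductSpace ℂ H]
    [CompleteSpace H] {F U : H →L[ℂ] H} {m : ℤ} (hm : IsSpectralFlowOfPair F U m) :
    SF F U = m := by
  have h : ∃ m, IsSpectralFlowOfPair F U m := ⟨m, hm⟩
  rw [SF, dif_pos h]
  exact h.choose_spec.unique hm

end SpectralFlowPairing

end

theorem mainTheorem5 {H : Type*} [NormedAddCommGroup H] [InnerProductSpace ℂ H] [CompleteSpace H]
    [TopologicalSpace.SeparableSpace H]
    (A : NonUnitalStarSubalgebra ℂ (H →L[ℂ] H)) (hA : IsClosed (A : Set (H →L[ℂ] H)))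
    (M : SpectralFlowPairing.OddFredholmModule A)
    (U : H →L[ℂ] H) (hUA : U ∈ A) (hU : U ∈ unitary (H →L[ℂ] H)) :
    (M.compression U).IsFredholm ∧
      SpectralFlowPairing.IsSpectralFlowOfPair M.F U (SpectralFlowPairing.SF M.F U) ∧
      M.pairing U = - SpectralFlowPairing.SF M.F U := by
  have hUF := M.isCompact_commutator U hUA
  have h := SpectralFlowPairing.OddFredholmModule.isSpectralFlowOfPair hU hUF
  rw [h.SF_eq]
  exact ⟨SpectralFlowPairing.OddFredholmModule.isFredholm_compression hU hUF, h,
    (neg_neg _).symm⟩
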